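/- **Setting.** $V\ge 1$ agents are the nodes of a connected undirected graph $G$ on $[V]$; $\mathcal N(i)$ denotes the set consisting of $i$ and its neighbors, $v_i=\min_{j\in\mathcal N(i)}|\mathcal N(j)|$ and $v_{\min}=\min_{j\in[V]}|\mathcal N(j)|$. There are $K\ge1$ arms with reward distributions $\nu_1,\dots,\nu_K$ on $[0,1]$ with means $\mu_k$; $\mu_{k^*}=\max_k\mu_k$, $\Delta_k=\mu_{k^*}-\mu_k$, $\Delta=\min_{\Delta_k>0}\Delta_k$. In each of $T$ rounds every agent $i$ pulls an arm $k_{i,t}$ and gets a reward $r_{i,t}\sim\nu_{k_{i,t}}$, independently over agents and rounds; $R_i(T)=T\mu_{k^*}-\mathbb E\big[\sum_{t=1}^T r_{i,t}\big]$. The communication cost $\mathrm{Cost}(T)$ is the number of pairs (agent $i$, round $t\le T$) such that $i$ broadcasts at $t$. A set $\mathcal C\subseteq[V]$ of agents is Byzantine, with $|\mathcal C\cap\mathcal N(i)|\le\alpha|\mathcal N(i)|$ for every normal agent $i\notin\mathcal C$, where $\alpha\in[0,\tfrac12)$ is known. Byzantine agents pull arbitrary arms and send arbitrary real-valued messages,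 possibly different ones to different neighbors; both may depend on everything that has happened in the system so far and on private randomness. **Algorithm** (DeMABAR with $w=1$; run by every normal agent $i$). Let $\lambda=2^9\ln(2VT)$ and $\Delta^0_{i,k}=1$ for all $k$. Epoch $m=1,2,\dots$ has $N_m=\big\lceil \lambda K2^{2(m-1)}/((1-2\alpha)v_{\min})\big\rceil$ exploration rounds and one communication round; the algorithm is stopped after round $T$. * Select an arm $k_i^m$ with $\Delta^{m-1}_{i,k_i^m}=2^{-(m-1)}$ (ties broken by any fixed rule). For $k\ne k_i^m$ let $\tilde n^m_{i,k}=\min\Big\{\frac{16\lambda(\Delta^{m-1}_{i,k})^{-2}}{(1-2\alpha)v_i},\frac{\lambda2^{2(m-1)}}{(1-2\alpha)v_i}\Big\}$, and let $\tilde n^m_{i,k_i^m}=N_m-\sum_{k\ne k_i^m}\tilde n^m_{i,k}$. * In each exploration round pull an arm drawn from $p_i^m(k)=\tilde n^m_{i,k}/N_m$; $S^m_{i,k}$ is the sum of the rewards obtained from arm $k$ in these rounds. * In the communication round pull $k_i^m$, broadcast $(\{S^m_{i,k}\}_k,\{\tilde n^m_{i,k}\}_k)$ to the neighbors and receive their messages.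 * For each arm $k$: let $n=\frac{\lambda(\Delta^{m-1}_{i,k})^{-2}}{(1-2\alpha)|\mathcal N(i)|}$ and $\mathcal A=\{j\in\mathcal N(i):\tilde n^m_{j,k}\ge n\}$ (according to the messages received); if $|\mathcal A|<(1-2\alpha)|\mathcal N(i)|$, reset $\mathcal A=\mathcal N(i)$. Let $f=\big\lfloor\frac12(|\mathcal A|-(1-2\alpha)|\mathcal N(i)|)\big\rfloor$, and let $r^m_{i,k}$ be the minimum of $1$ and the average of the values $S^m_{j,k}/\tilde n^m_{j,k}$, $j\in\mathcal A$, that remain after the $f$ largest and the $f$ smallest are removed. * Let $r^m_{i,*}=\max_k\{r^m_{i,k}-\frac18\Delta^{m-1}_{i,k}\}$ and $\Delta^m_{i,k}=\max\{2^{-m},r^m_{i,*}-r^m_{i,k}\}$. Only messages sent in communication rounds are read, and only these broadcasts are counted, for Byzantine agents as well. **Theorem.** There is a universal constant $C>0$ such that, for all $V$ and $K$: (1) for every $T\ge1$, every network and every admissible $\alpha$ and $\mathcal C$, $\ \mathrm{Cost}(T)\le C\,V\ln(VT)$; (2) for all sufficiently large $T$ (with a threshold that depends only on $V$ and $K$),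 for every network $G$, every $\alpha\in[0,\frac12)$, all reward distributions $\nu_1,\dots,\nu_K$ on $[0,1]$, every set $\mathcal C$ of Byzantine agents as above with any behavior, and every normal agent $i$, $$R_i(T)\le C\,\frac{\ln(VT)}{1-2\alpha}\bigg(\sum_{\Delta_k>0}\frac{\ln(VT)}{v_i\,\Delta_k}+\frac{K\ln(\frac1\Delta)}{v_{\min}\,\Delta}\bigg),$$ where the right-hand side is read as $0$ if all arms are optimal. -/

import Mathlib

open MeasureTheory ProbabilityTheory

noncomputable section

namespace DeMABAR

/-- The `w`-neighbourhood of `i`: all nodes at graph distance at most `w` (in particular `i`). -/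
def nbhd {V : ℕ} (G : SimpleGraph (Fin V)) (w : ℕ) (i : Fin V) : Finset (Fin V) :=
  open Classical in Finset.univ.filter fun j => G.dist i j ≤ w

/-- `v_i^w`, the least size of a `w`-neighbourhood of a node in the `w`-neighbourhood of `i`. -/
def vLoc {V : ℕ} (G : SimpleGraph (Fin V)) (w : ℕ) (i : Fin V) : ℕ :=
  ⨅ j : {j : Fin V // j ∈ nbhd G w i}, (nbhd G w j.1).card

/-- `v_min^w`, the least size of a `w`-neighbourhood. -/
def vMin {V : ℕ} (G : SimpleGraph (Fin V)) (w : ℕ) : ℕ :=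
  ⨅ j : Fin V, (nbhd G w j).card

/-- The data the algorithm is run with. Rounds are numbered `0, …, T - 1` and epochs
`0, 1, 2, …`. The rule `sel m i` picks one arm among those that qualify as the leading arm
of agent `i` in epoch `m`. -/
structure Setup (V K : ℕ) where
  /-- the communication network -/
  G : SimpleGraph (Fin V)
  /-- the tolerated fraction of Byzantine neighbours -/
  α : ℝ
  /-- the horizon -/
  T : ℕ
  /-- the set of Byzantine agents (not known to the algorithm) -/
  byz : Finset (Fin V)
  /-- how the algorithm breaks ties when it selects the leading arm -/
  sel : ℕ → Fin V → Finset (Fin K) → Fin K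

/-- The standing assumptions of the Byzantine setting. -/
structure Setup.Admissible {V K : ℕ} (P : Setup V K) : Prop where
  connected : P.G.Connected
  alpha_nonneg : 0 ≤ P.α
  alpha_lt : P.α < 1 / 2
  byz_fraction : ∀ i, i ∉ P.byz →
    ((P.byz ∩ nbhd P.G 1 i).card : ℝ) ≤ P.α * ((nbhd P.G 1 i).card : ℝ)
  sel_mem : ∀ m i s, s.Nonempty → P.sel m i s ∈ s

/-- A message `(S, ñ)`: for every arm, a reward sum and a number of pulls. -/
abbrev Message (K : ℕ) := (Fin K → ℝ) × (Fin K → ℝ)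

/-- Everything that drives one run, for one outcome of the randomness. -/
structure Path (V K : ℕ) where
  /-- `u t i`: the seed with which agent `i` draws its arm in round `t` -/
  u : ℕ → Fin V → ℝ
  /-- `x t i k`: the reward agent `i` gets in round `t` if it pulls arm `k` -/
  x : ℕ → Fin V → Fin K → ℝ
  /-- `z m j i`: what a Byzantine agent `j` sends to agent `i` at the end of epoch `m` -/
  z : ℕ → Fin V → Fin V → Message K
  /-- `a t j`: the arm a Byzantine agent `j` pulls in round `t` -/
  a : ℕ → Fin V → Fin K

/-- Drawing from the probability vector `p` by inversion: the first arm whose cumulative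
probability exceeds the seed. -/
def draw {K : ℕ} [NeZero K] (p : Fin K → ℝ) (u : ℝ) : Fin K :=
  open Classical in
  if h : (Finset.univ.filter fun k => u < ∑ l ∈ Finset.Iic k, p l).Nonempty
  then (Finset.univ.filter fun k => u < ∑ l ∈ Finset.Iic k, p l).min' h
  else 0

/-- The average of the numbers `y j`, `j ∈ A`, without the `f` largest and the `f` smallest. -/
def trimmedMean {V : ℕ} (A : Finset (Fin V)) (f : ℕ) (y : Fin V → ℝ) : ℝ :=
  let kept := (((A.val.map y).sort (· ≥ ·)).drop f).take (A.card - 2 * f)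
  kept.sum / (kept.length : ℝ)

namespace Setup

variable {V K : ℕ} (P : Setup V K)

/-- `λ = 2⁹ ln(2VT)`. -/
def lam : ℝ := 2 ^ 9 * Real.log (2 * V * P.T)

/-- The number of exploration rounds of epoch `m`. -/
def len (m : ℕ) : ℕ :=
  ⌈P.lam * K * 2 ^ (2 * m) / ((1 - 2 * P.α) * vMin P.G 1)⌉₊

/-- The first round of epoch `m`: an epoch has `len m` exploration rounds, followed by one
communication round. -/
def start : ℕ → ℕ
  | 0 => 0
  | m + 1 => start m + P.len m + 1

/-- The epoch to which round `t` belongs. -/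
def epoch (t : ℕ) : ℕ := Nat.findGreatest (fun m => P.start m ≤ t) t

/-- Round `t` is the communication round of its epoch. -/
def IsComm (t : ℕ) : Prop := t = P.start (P.epoch t) + P.len (P.epoch t)

/-- The communication cost: the number of pairs (agent, round) such that the agent broadcasts
in that round. Agents broadcast in the communication rounds only; Byzantine agents are counted
as well, and what they might send in other rounds is never read. -/
def cost : ℕ :=
  open Classical in ∑ _i : Fin V, ∑ t ∈ Finset.range P.T, if P.IsComm t then 1 else 0

/-- The leading arm in epoch `m` of agent `i`, whose gap estimates are `Δ`. -/
def lead (m : ℕ) (i : Fin V) (Δ : Fin K → ℝ) : Fin K :=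
  open Classical in P.sel m i (Finset.univ.filter fun k => Δ k = (1 / 2) ^ m)

/-- The intended number of pulls of an arm with gap estimate `δ` that is not leading. -/
def baseAlloc (m : ℕ) (i : Fin V) (δ : ℝ) : ℝ :=
  min (16 * P.lam * (δ ^ 2)⁻¹ / ((1 - 2 * P.α) * vLoc P.G 1 i))
    (P.lam * 2 ^ (2 * m) / ((1 - 2 * P.α) * vLoc P.G 1 i))

/-- `ñ`: the intended number of pulls of arm `k` by agent `i` in epoch `m`; the leading arm
takes all the rounds that the other arms leave. -/
def alloc (m : ℕ) (i : Fin V) (Δ : Fin K → ℝ) (k : Fin K) : ℝ :=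
  open Classical in
  if k = P.lead m i Δ
  then P.len m - ∑ l ∈ Finset.univ.erase (P.lead m i Δ), P.baseAlloc m i (Δ l)
  else P.baseAlloc m i (Δ k)

/-- The arm agent `i` draws in an exploration round of epoch `m` with seed `u`. -/
def explore [NeZero K] (m : ℕ) (i : Fin V) (Δ : Fin K → ℝ) (u : ℝ) : Fin K :=
  draw (fun k => P.alloc m i Δ k / P.len m) u

/-- `S`: the rewards agent `i` collects from arm `k` in the exploration rounds of epoch `m`. -/
def rewardSum [NeZero K] (m : ℕ) (i : Fin V) (Δ : Fin K → ℝ) (ξ : Path V K) (k : Fin K) : ℝ :=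
  ∑ t ∈ Finset.Ico (P.start m) (P.start m + P.len m),
    if P.explore m i Δ (ξ.u t i) = k then ξ.x t i k else 0

/-- The message that `i` gets from `j` at the end of epoch `m`: the true one if `j` is normal,
any one if `j` is Byzantine. -/
def message [NeZero K] (m : ℕ) (Δ : Fin V → Fin K → ℝ) (ξ : Path V K) (j i : Fin V) :
    Message K :=
  if j ∈ P.byz then ξ.z m j i else (P.rewardSum m j (Δ j) ξ, P.alloc m j (Δ j))

/-- The filter step of agent `i` for arm `k`, with gap estimate `δ` and messages `msg j`.
Messages with too small a number of pulls are removed; if this leaves too few of them, all are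
restored. -/
def estimate (i : Fin V) (δ : ℝ) (msg : Fin V → Message K) (k : Fin K) : ℝ :=
  open Classical in
  let N := nbhd P.G 1 i
  let n := P.lam * (δ ^ 2)⁻¹ / ((1 - 2 * P.α) * N.card)
  let A₀ := N.filter fun j => n ≤ (msg j).2 k
  let A := if (A₀.card : ℝ) < (1 - 2 * P.α) * N.card then N else A₀
  let f := ⌊((A.card : ℝ) - (1 - 2 * P.α) * N.card) / 2⌋₊
  min (trimmedMean A f fun j => (msg j).1 k / (msg j).2 k) 1

/-- `gap ξ m i k`: the estimate by agent `i` of the gap of arm `k` at the start of epoch `m`. -/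
def gap [NeZero K] (ξ : Path V K) : ℕ → Fin V → Fin K → ℝ
  | 0 => fun _ _ => 1
  | m + 1 => fun i k =>
      let r : Fin K → ℝ := fun l =>
        P.estimate i (gap ξ m i l) (fun j => P.message m (gap ξ m) ξ j i) l
      max ((1 / 2) ^ (m + 1)) ((⨆ l, (r l - gap ξ m i l / 8)) - r k)

/-- The arm that agent `i` pulls in round `t`. -/
def arm [NeZero K] (ξ : Path V K) (t : ℕ) (i : Fin V) : Fin K :=
  open Classical in
  if i ∈ P.byz then ξ.a t i
  else if P.IsComm t then P.lead (P.epoch t) i (P.gap ξ (P.epoch t) i)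
  else P.explore (P.epoch t) i (P.gap ξ (P.epoch t) i) (ξ.u t i)

/-- The random environment, with reward distributions `ν k`, together with the behaviour of the
Byzantine agents. In each round, the seeds are uniform on `[0, 1]` and the reward vectors have
independent coordinates with laws `ν k`, independently over agents and independently of the
past. The σ-algebra `ℱ t` holds everything known before round `t`, including any private
randomness of the Byzantine agents; these may use all that has happened in the whole system. -/
structure Environment (ν : Fin K → Measure ℝ) {Ω : Type*} [mΩ : MeasurableSpace Ω]
    (Q : Measure Ω) where
  ℱ : Filtration ℕ mΩ
  path : Ω → Path V K
  measurable_u : ∀ t i, Measurable[ℱ (t + 1)] fun ω => (path ω).u t i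
  measurable_x : ∀ t i, Measurable[ℱ (t + 1)] fun ω => (path ω).x t i
  measurable_z : ∀ m j i, Measurable[ℱ (P.start (m + 1))] fun ω => (path ω).z m j i
  measurable_a : ∀ t j, Measurable[ℱ (t + 1)] fun ω => (path ω).a t j
  law : ∀ t, Q.map (fun ω (i : Fin V) => ((path ω).u t i, (path ω).x t i)) =
    Measure.pi fun _ => ((volume.restrict (Set.Icc (0 : ℝ) 1)).prod (Measure.pi ν))
  indep : ∀ t, Indep (ℱ t)
    (MeasurableSpace.comap (fun ω (i : Fin V) => ((path ω).u t i, (path ω).x t i)) inferInstance)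
    Q

end Setup

variable {K : ℕ}

/-- `μ_k`. -/
def mean (ν : Fin K → Measure ℝ) (k : Fin K) : ℝ := ∫ y, y ∂(ν k)

/-- `μ_{k*}`. -/
def bestMean (ν : Fin K → Measure ℝ) : ℝ := ⨆ k, mean ν k

/-- `Δ_k`. -/
def subGap (ν : Fin K → Measure ℝ) (k : Fin K) : ℝ := bestMean ν - mean ν k

/-- `Δ`, the smallest positive gap. -/
def minGap (ν : Fin K → Measure ℝ) : ℝ := ⨅ k : {k : Fin K // 0 < subGap ν k}, subGap ν k.1

/-- `R_i(T) = T μ_{k*} - E[∑_t r_{i,t}]`. -/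
def regret {V : ℕ} [NeZero K] (P : Setup V K) (ν : Fin K → Measure ℝ) {Ω : Type*}
    [MeasurableSpace Ω] {Q : Measure Ω} (E : P.Environment ν Q) (i : Fin V) : ℝ :=
  P.T * bestMean ν -
    ∫ ω, ∑ t ∈ Finset.range P.T, (E.path ω).x t i (P.arm (E.path ω) t i) ∂Q

end DeMABAR

end

/-! The proof separates a deterministic analysis of runs with accurate samples from a probability
bound for the other runs.

Deterministic part. `Accurate` says that, for all large enough sets `W` of normal agents with enough
pulls, the pooled empirical mean of an arm is within an eighth of the receiver's gap estimate. At
most `f` Byzantine messages survive the filter, so the trimmed mean lies between averages over two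
sets of normal agents (`trimmedMean_le`, `le_trimmedMean`). These sets depend on the data and on the
adversary, which is why accuracy is required for every `W`, at the price of a factor `2 ^ V` in the
union bound. Accurate estimates keep each gap estimate between `24/49 Δ_k` and `8/7 Δ_k + 2⁻ᵐ`
(`gapBounds_succ`). These bounds in turn make the estimates of any two normal agents comparable, so
that normal neighbours keep passing the filter.

Probabilistic part. However corrupted, the gap estimates of an epoch are fixed before its first
round, and given the past its rounds are independent with known laws. A product of exponentially
tilted rewards therefore has mean at most one (`lintegral_prod_rounds_le_one`), and Markov's
inequality bounds each deviation by `(2VT)⁻²`. A union bound leaves a failure probability of at most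
`K 2^V / T`, hence at most `K 2^V` of regret.

Regret. With correct estimates, a non-leading arm costs at most about `λ / ((1 - 2α) v_i Δ_k)` per
epoch, over `O(ln(VT))` epochs. A leading arm can be suboptimal only while `2ᵐ Δ_k ≤ 49/24`; epoch
length times gap is then of order `2ᵐ`, and the geometric sum gives `λ K / ((1 - 2α) v_min Δ)`. The
bound on the number of epochs (`lt_len`) also gives the communication cost. -/

namespace DeMABAR

/-! ### Trimmed means -/

/-- A finite set can be listed in decreasing order of `y`. -/
theorem exists_sorted_list {V : ℕ} (A : Finset (Fin V)) (y : Fin V → ℝ) :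
    ∃ L : List (Fin V), L.Perm A.toList ∧ L.Pairwise fun a b => y b ≤ y a := by
  refine ⟨A.toList.mergeSort (fun a b => decide (y b ≤ y a)), List.mergeSort_perm _ _, ?_⟩
  have := List.pairwise_mergeSort (le := fun a b => decide (y b ≤ y a))
    (fun a b c h1 h2 => by
      simp only [decide_eq_true_eq] at *
      exact h2.trans h1)
    (fun a b => by
      simp only [Bool.or_eq_true, decide_eq_true_eq]
      exact le_total _ _) A.toList
  simpa using this

/-- The trimmed mean in terms of any decreasing listing of the index set. -/
theorem trimmedMean_eq_of_sorted {V : ℕ} {A : Finset (Fin V)} {y : Fin V → ℝ} {f : ℕ}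
    {L : List (Fin V)} (hL : L.Perm A.toList) (hs : L.Pairwise fun a b => y b ≤ y a) :
    trimmedMean A f y = (((L.drop f).take (A.card - 2 * f)).map y).sum /
      (((L.drop f).take (A.card - 2 * f)).length : ℝ) := by
  have key : (A.val.map y).sort (· ≥ ·) = L.map y := by
    refine List.Perm.eq_of_pairwise (le := (· ≥ ·)) (fun a b _ _ h1 h2 => le_antisymm h2 h1)
      (Multiset.pairwise_sort _ _) ?_ ?_
    · rw [List.pairwise_map]; exact hs
    · rw [← Multiset.coe_eq_coe, Multiset.sort_eq, ← Multiset.map_coe,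
        Multiset.coe_eq_coe.mpr hL, Finset.coe_toList]
  unfold trimmedMean
  simp only [key, ← List.map_drop, ← List.map_take, List.length_map]

/-- The trimmed mean is the average over a middle part of the index set, with the top `f` indices
above it and the bottom `f` indices below it. -/
theorem exists_trim_partition {V : ℕ} (A : Finset (Fin V)) (y : Fin V → ℝ) {f : ℕ}
    (hf : 2 * f < A.card) :
    ∃ top mid bot : Finset (Fin V), top ⊆ A ∧ mid ⊆ A ∧ bot ⊆ A ∧ Disjoint top mid ∧
      Disjoint mid bot ∧ top.card = f ∧ mid.card = A.card - 2 * f ∧ bot.card = f ∧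
      (∀ a ∈ top, ∀ b ∈ mid, y b ≤ y a) ∧ (∀ a ∈ mid, ∀ b ∈ bot, y b ≤ y a) ∧
      trimmedMean A f y = (∑ j ∈ mid, y j) / mid.card := by
  classical
  obtain ⟨L, hL, hs⟩ := exists_sorted_list A y
  have hn : L.Nodup := hL.nodup_iff.mpr A.nodup_toList
  have hlen : L.length = A.card := by rw [hL.length_eq, Finset.length_toList]
  set s := A.card - 2 * f with hsdef
  set L₁ := L.take f with hL₁
  set L₂ := (L.drop f).take s with hL₂
  set L₃ := (L.drop f).drop s with hL₃
  have hsplit : L = L₁ ++ (L₂ ++ L₃) := by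
    rw [hL₁, hL₂, hL₃, List.take_append_drop, List.take_append_drop]
  have hmem : ∀ a ∈ L, a ∈ A := fun a ha => by
    have := hL.mem_iff.mp ha
    simpa using this
  have hs' := hs
  rw [hsplit] at hn hs
  rw [List.nodup_append', List.nodup_append'] at hn
  obtain ⟨n1, ⟨n2, n3, d23⟩, d1⟩ := hn
  rw [List.pairwise_append, List.pairwise_append] at hs
  obtain ⟨-, ⟨-, -, s23⟩, s1⟩ := hs
  have c1 : L₁.toFinset.card = f := by
    rw [List.toFinset_card_of_nodup n1, hL₁, List.length_take]; omega
  have c2 : L₂.toFinset.card = s := by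
    rw [List.toFinset_card_of_nodup n2, hL₂, List.length_take, List.length_drop]; omega
  have c3 : L₃.toFinset.card = f := by
    rw [List.toFinset_card_of_nodup n3, hL₃, List.length_drop, List.length_drop]; omega
  refine ⟨L₁.toFinset, L₂.toFinset, L₃.toFinset, ?_, ?_, ?_, ?_, ?_, c1, c2, c3, ?_, ?_, ?_⟩
  · intro a ha
    have h := List.mem_toFinset.mp ha
    exact hmem a (hsplit ▸ List.mem_append_left _ h)
  · intro a ha
    have h := List.mem_toFinset.mp ha
    exact hmem a (hsplit ▸ List.mem_append_right _ (List.mem_append_left _ h))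
  · intro a ha
    have h := List.mem_toFinset.mp ha
    exact hmem a (hsplit ▸ List.mem_append_right _ (List.mem_append_right _ h))
  · rw [Finset.disjoint_left]
    intro a h1 h2
    exact d1 (List.mem_toFinset.mp h1) (List.mem_append_left _ (List.mem_toFinset.mp h2))
  · rw [Finset.disjoint_left]
    intro a h1 h2
    exact d23 (List.mem_toFinset.mp h1) (List.mem_toFinset.mp h2)
  · intro a ha b hb
    exact s1 a (List.mem_toFinset.mp ha) b (List.mem_append_left _ (List.mem_toFinset.mp hb))
  · intro a ha b hb
    exact s23 a (List.mem_toFinset.mp ha) b (List.mem_toFinset.mp hb)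
  · rw [trimmedMean_eq_of_sorted hL hs', ← hL₂, List.sum_toFinset _ n2,
      List.toFinset_card_of_nodup n2]

/-- Replacing the outliers in `mid` by members of `top` increases the sum. -/
theorem exists_subset_sum_ge {V : ℕ} {A g top mid : Finset (Fin V)} {y : Fin V → ℝ} {f : ℕ}
    (htop : top ⊆ A) (hmid : mid ⊆ A) (hd : Disjoint top mid) (hc : top.card = f)
    (hy : ∀ a ∈ top, ∀ b ∈ mid, y b ≤ y a) (hg : (A \ g).card ≤ f) :
    ∃ W ⊆ g, W.card = mid.card ∧ ∑ j ∈ mid, y j ≤ ∑ j ∈ W, y j := by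
  classical
  -- The outliers in `mid` and in `top` together number at most `f = top.card`, so `top` has enough
  -- good members to replace each outlier of `mid`, and each of them is at least as large.
  have h1 : (mid \ g).card ≤ (top ∩ g).card := by
    have hsub : (mid \ g) ∪ (top \ g) ⊆ A \ g :=
      Finset.union_subset (Finset.sdiff_subset_sdiff hmid le_rfl)
        (Finset.sdiff_subset_sdiff htop le_rfl)
    have hcard := Finset.card_le_card hsub
    rw [Finset.card_union_of_disjoint (hd.symm.mono Finset.sdiff_subset Finset.sdiff_subset)]
      at hcard
    have := Finset.card_sdiff_add_card_inter top g
    omega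
  obtain ⟨U, hU, hUc⟩ := Finset.exists_subset_card_eq h1
  have hUtop : U ⊆ top := hU.trans Finset.inter_subset_left
  have hdis : Disjoint (mid ∩ g) U :=
    hd.symm.mono Finset.inter_subset_left hUtop
  refine ⟨(mid ∩ g) ∪ U, Finset.union_subset Finset.inter_subset_right
    (hU.trans Finset.inter_subset_right), ?_, ?_⟩
  · rw [Finset.card_union_of_disjoint hdis, hUc]
    have := Finset.card_sdiff_add_card_inter mid g
    omega
  · rw [Finset.sum_union hdis, ← Finset.sum_inter_add_sum_sdiff mid g]
    refine add_le_add le_rfl ?_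
    rcases (mid \ g).eq_empty_or_nonempty with he | ⟨b₀, hb₀⟩
    · rw [he] at hUc ⊢
      have hU0 : U = ∅ := Finset.card_eq_zero.mp (by simpa using hUc)
      rw [hU0]
    · have hne : (mid \ g).Nonempty := ⟨b₀, hb₀⟩
      obtain ⟨b, hb, hbmax⟩ := Finset.exists_max_image (mid \ g) y hne
      calc ∑ j ∈ mid \ g, y j ≤ (mid \ g).card • y b := Finset.sum_le_card_nsmul _ _ _ hbmax
        _ = U.card • y b := by rw [hUc]
        _ ≤ ∑ j ∈ U, y j := Finset.card_nsmul_le_sum _ _ _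
          fun a ha => hy a (hUtop ha) b (Finset.mem_sdiff.mp hb).1

/-- If at most `f` of the values do not belong to `g`, the trimmed mean is at most the average
over some subset of `g`. -/
theorem trimmedMean_le {V : ℕ} {A g : Finset (Fin V)} (y : Fin V → ℝ) {f : ℕ}
    (hf : 2 * f < A.card) (hg : (A \ g).card ≤ f) :
    ∃ W ⊆ g, W.card = A.card - 2 * f ∧ trimmedMean A f y ≤ (∑ j ∈ W, y j) / W.card := by
  obtain ⟨top, mid, bot, h1, h2, h3, d1, d2, c1, c2, c3, o1, o2, h⟩ := exists_trim_partition A y hf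
  obtain ⟨W, hW, hc, hs⟩ := exists_subset_sum_ge h1 h2 d1 c1 o1 hg
  refine ⟨W, hW, hc.trans c2, ?_⟩
  rw [h, hc]
  gcongr

/-- If at most `f` of the values do not belong to `g`, the trimmed mean is at least the average
over some subset of `g`. -/
theorem le_trimmedMean {V : ℕ} {A g : Finset (Fin V)} (y : Fin V → ℝ) {f : ℕ}
    (hf : 2 * f < A.card) (hg : (A \ g).card ≤ f) :
    ∃ W ⊆ g, W.card = A.card - 2 * f ∧ (∑ j ∈ W, y j) / W.card ≤ trimmedMean A f y := by
  obtain ⟨top, mid, bot, h1, h2, h3, d1, d2, c1, c2, c3, o1, o2, h⟩ := exists_trim_partition A y hf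
  -- Negating the values turns the bottom part into the top part.
  obtain ⟨W, hW, hc, hs⟩ := exists_subset_sum_ge (y := fun j => - y j) h3 h2 d2.symm c3
    (fun a ha b hb => neg_le_neg (o2 b hb a ha)) hg
  refine ⟨W, hW, hc.trans c2, ?_⟩
  rw [h, hc]
  simp only [Finset.sum_neg_distrib, neg_le_neg_iff] at hs
  gcongr

/-! ### Measurability of functions with a countable choice -/

/-- A function whose definition depends on a countable parameter with measurable fibres. -/
theorem measurable_of_fibres {Ω β ι : Type*} [MeasurableSpace Ω] [MeasurableSpace β] [Countable ι]
    {F : Ω → ι} (hF : ∀ a, MeasurableSet {ω | F ω = a}) {g : ι → Ω → β}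
    (hg : ∀ a, Measurable (g a)) : Measurable fun ω => g (F ω) ω := by
  intro s hs
  have : (fun ω => g (F ω) ω) ⁻¹' s = ⋃ a, {ω | F ω = a} ∩ g a ⁻¹' s := by
    ext ω; simp
  rw [this]
  exact MeasurableSet.iUnion fun a => (hF a).inter (hg a hs)

/-- The fibres of a random finite set. -/
theorem measurableSet_fibre_finset {Ω ι : Type*} [MeasurableSpace Ω] [Finite ι]
    {F : Ω → Finset ι} (hF : ∀ k, MeasurableSet {ω | k ∈ F ω}) (s : Finset ι) :
    MeasurableSet {ω | F ω = s} := by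
  have : {ω | F ω = s} = ⋂ k, {ω | k ∈ F ω ↔ k ∈ s} := by
    ext ω; simp [Finset.ext_iff]
  rw [this]
  refine MeasurableSet.iInter fun k => ?_
  by_cases hk : k ∈ s
  · simp only [hk, iff_true]
    exact hF k
  · simp only [hk, iff_false]
    exact (hF k).compl

/-- The space splits into countably many measurable pieces, one for each listing of `A` that is
decreasing in `y`; on each piece the trimmed mean is a fixed linear function. -/
theorem measurable_trimmedMean {V : ℕ} (A : Finset (Fin V)) (f : ℕ) :
    Measurable (trimmedMean A f) := by
  intro s hs
  have : trimmedMean A f ⁻¹' s = ⋃ L : {L : List (Fin V) // L.Perm A.toList},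
      {y : Fin V → ℝ | L.1.Pairwise fun a b => y b ≤ y a} ∩
        (fun y : Fin V → ℝ => (((L.1.drop f).take (A.card - 2 * f)).map y).sum /
          (((L.1.drop f).take (A.card - 2 * f)).length : ℝ)) ⁻¹' s := by
    ext y
    simp only [Set.mem_preimage, Set.mem_iUnion, Set.mem_inter_iff, Set.mem_ofPred_eq,
      Subtype.exists, exists_prop]
    constructor
    · intro hy
      obtain ⟨L, hL, hLs⟩ := exists_sorted_list A y
      exact ⟨L, hL, hLs, by rwa [← trimmedMean_eq_of_sorted hL hLs]⟩
    · rintro ⟨L, hL, hLs, hy⟩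
      rwa [trimmedMean_eq_of_sorted hL hLs]
  rw [this]
  refine MeasurableSet.iUnion fun L => MeasurableSet.inter ?_ ?_
  · have hset : {y : Fin V → ℝ | L.1.Pairwise fun a b => y b ≤ y a} =
        ⋂ (i : Fin L.1.length) (j : Fin L.1.length) (_ : i < j),
          {y : Fin V → ℝ | y (L.1.get j) ≤ y (L.1.get i)} := by
      ext y; simp [List.pairwise_iff_get]
    rw [hset]
    refine MeasurableSet.iInter fun i => MeasurableSet.iInter fun j => MeasurableSet.iInter
      fun _ => measurableSet_le (measurable_pi_apply _) (measurable_pi_apply _)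
  · refine Measurable.div_const ?_ _ hs
    have : ∀ l : List (Fin V), Measurable fun y : Fin V → ℝ => (l.map y).sum := by
      intro l
      induction l with
      | nil => simp
      | cons a l ih =>
        simp only [List.map_cons, List.sum_cons]
        exact (measurable_pi_apply a).add ih
    exact this _

end DeMABAR

namespace DeMABAR

/-! ### Neighbourhoods -/

section Neighbourhoods

variable {V : ℕ} (G : SimpleGraph (Fin V)) (w : ℕ)

theorem mem_nbhd {i j : Fin V} : j ∈ nbhd G w i ↔ G.dist i j ≤ w := by
  simp [nbhd]

theorem self_mem_nbhd (i : Fin V) : i ∈ nbhd G w i := by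
  simp [mem_nbhd]

theorem mem_nbhd_comm {i j : Fin V} : j ∈ nbhd G w i ↔ i ∈ nbhd G w j := by
  rw [mem_nbhd, mem_nbhd, G.dist_comm]

theorem nbhd_card_pos (i : Fin V) : 0 < (nbhd G w i).card :=
  Finset.card_pos.mpr ⟨i, self_mem_nbhd G w i⟩

theorem vLoc_le_card {i j : Fin V} (hj : j ∈ nbhd G w i) : vLoc G w i ≤ (nbhd G w j).card :=
  ciInf_le (OrderBot.bddBelow _) (⟨j, hj⟩ : {j : Fin V // j ∈ nbhd G w i})

theorem vMin_le_card (j : Fin V) : vMin G w ≤ (nbhd G w j).card :=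
  ciInf_le (OrderBot.bddBelow _) j

theorem vMin_le_vLoc (i : Fin V) : vMin G w ≤ vLoc G w i := by
  have : Nonempty {j : Fin V // j ∈ nbhd G w i} := ⟨⟨i, self_mem_nbhd G w i⟩⟩
  exact le_ciInf fun j => vMin_le_card G w j.1

theorem vMin_pos (i : Fin V) : 0 < vMin G w := by
  have : Nonempty (Fin V) := ⟨i⟩
  exact Nat.lt_of_succ_le (le_ciInf fun j => nbhd_card_pos G w j)

theorem vLoc_le (i : Fin V) : vLoc G w i ≤ V :=
  (vLoc_le_card G w (self_mem_nbhd G w i)).trans (card_finset_fin_le _)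

theorem vMin_le (i : Fin V) : vMin G w ≤ V := (vMin_le_vLoc G w i).trans (vLoc_le G w i)

theorem vLoc_pos (i : Fin V) : 0 < vLoc G w i := (vMin_pos G w i).trans_le (vMin_le_vLoc G w i)

end Neighbourhoods

/-! ### The schedule of rounds -/

namespace Setup

variable {V K : ℕ} (P : Setup V K)

theorem start_strictMono : StrictMono P.start :=
  strictMono_nat_of_lt_succ fun m => by simp only [start]; omega

theorem start_epoch_le (t : ℕ) : P.start (P.epoch t) ≤ t :=
  Nat.findGreatest_spec (P := fun m => P.start m ≤ t) (Nat.zero_le t) (by simp [start])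

theorem lt_start_epoch_succ (t : ℕ) : t < P.start (P.epoch t + 1) := by
  by_contra! h
  -- The search that defines `epoch t` stops at `t`; this loses nothing because `m ≤ start m`.
  have h1 : P.epoch t + 1 ≤ t := P.start_strictMono.le_apply.trans h
  have h2 : P.epoch t + 1 ≤ P.epoch t := Nat.le_findGreatest (P := fun m => P.start m ≤ t) h1 h
  omega

theorem epoch_eq {m t : ℕ} (h1 : P.start m ≤ t) (h2 : t < P.start (m + 1)) : P.epoch t = m := by
  have h3 := P.start_strictMono.lt_iff_lt.mp (h1.trans_lt (P.lt_start_epoch_succ t))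
  have h4 := P.start_strictMono.lt_iff_lt.mp ((P.start_epoch_le t).trans_lt h2)
  omega

theorem epoch_explore {m t : ℕ} (ht : t ∈ Finset.Ico (P.start m) (P.start m + P.len m)) :
    P.epoch t = m ∧ ¬ P.IsComm t := by
  rw [Finset.mem_Ico] at ht
  have h : P.epoch t = m := P.epoch_eq ht.1 (by simp only [start]; omega)
  refine ⟨h, ?_⟩
  rw [IsComm, h]
  omega

theorem epoch_comm (m : ℕ) :
    P.epoch (P.start m + P.len m) = m ∧ P.IsComm (P.start m + P.len m) := by
  have h : P.epoch (P.start m + P.len m) = m :=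
    P.epoch_eq (by omega) (by simp only [start]; omega)
  exact ⟨h, by rw [IsComm, h]⟩

theorem sum_range_start (φ : ℕ → ℝ) (M : ℕ) :
    ∑ t ∈ Finset.range (P.start M), φ t = ∑ m ∈ Finset.range M,
      (∑ t ∈ Finset.Ico (P.start m) (P.start m + P.len m), φ t + φ (P.start m + P.len m)) := by
  induction M with
  | zero => simp [start]
  | succ M ih =>
    rw [Finset.sum_range_succ, ← ih, Finset.range_eq_Ico, Finset.range_eq_Ico,
      ← Finset.sum_Ico_succ_top (by omega),
      Finset.sum_Ico_consecutive φ (Nat.zero_le _) (by omega)]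
    rfl

/-- There is at least one agent. -/
theorem Admissible.pos_card {P : Setup V K} (hP : P.Admissible) : 0 < V := by
  obtain ⟨i⟩ := hP.connected.nonempty
  exact i.pos

theorem Admissible.one_sub_pos {P : Setup V K} (hP : P.Admissible) : 0 < 1 - 2 * P.α := by
  have := hP.alpha_lt
  linarith

theorem Admissible.one_sub_le {P : Setup V K} (hP : P.Admissible) : 1 - 2 * P.α ≤ 1 := by
  have := hP.alpha_nonneg
  linarith

theorem Admissible.one_le_mul {P : Setup V K} (hP : P.Admissible) (hT : 1 ≤ P.T) :
    (1 : ℝ) ≤ V * P.T := by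
  have h1 := hP.pos_card
  exact_mod_cast Nat.mul_pos h1 hT

theorem Admissible.le_lam {P : Setup V K} (hP : P.Admissible) (hT : 1 ≤ P.T) : 256 ≤ P.lam := by
  have h := hP.one_le_mul hT
  have h2 : Real.log 2 ≤ Real.log (2 * V * P.T) :=
    Real.log_le_log (by norm_num) (by nlinarith)
  have := Real.log_two_gt_d9
  rw [lam]
  linarith

theorem Admissible.lam_pos {P : Setup V K} (hP : P.Admissible) (hT : 1 ≤ P.T) : 0 < P.lam := by
  linarith [hP.le_lam hT]

/-! ### Length and number of the epochs, communication cost -/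

theorem le_len (m : ℕ) :
    P.lam * K * 2 ^ (2 * m) / ((1 - 2 * P.α) * vMin P.G 1) ≤ P.len m := Nat.le_ceil _

/-- Epochs with a large number are longer than the horizon. -/
theorem Admissible.lt_len [NeZero K] {P : Setup V K} (hP : P.Admissible) (hT : 1 ≤ P.T) {m : ℕ}
    (hm : Nat.log 2 (V * P.T) ≤ m) : P.T < P.len m := by
  have hV : (0 : ℝ) < V := by exact_mod_cast hP.pos_card
  obtain ⟨i⟩ := hP.connected.nonempty
  have hK : (1 : ℝ) ≤ K := by exact_mod_cast NeZero.one_le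
  have hα := hP.one_sub_pos
  have hα' := hP.one_sub_le
  have hv : (0 : ℝ) < vMin P.G 1 := by exact_mod_cast vMin_pos P.G 1 i
  have hv' : (vMin P.G 1 : ℝ) ≤ V := by exact_mod_cast vMin_le P.G 1 i
  have hl := hP.le_lam hT
  -- As `(1 - 2α) v_min ≤ V`, it is enough that `VT` is below `λ K 4ᵐ`, and already `VT < 2 · 2ᵐ`.
  have h1 : V * P.T < 2 ^ (m + 1) := by
    calc V * P.T < 2 ^ (Nat.log 2 (V * P.T) + 1) := Nat.lt_pow_succ_log_self (by norm_num) _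
      _ ≤ 2 ^ (m + 1) := Nat.pow_le_pow_right (by norm_num) (by omega)
  have h1' : (V : ℝ) * P.T < 2 ^ (m + 1) := by exact_mod_cast h1
  have h2 : (2 : ℝ) ^ m ≤ 2 ^ (2 * m) := pow_le_pow_right₀ (by norm_num) (by omega)
  have h3 : (P.T : ℝ) < P.len m := by
    refine lt_of_lt_of_le ?_ (P.le_len m)
    rw [lt_div_iff₀ (by positivity)]
    calc (P.T : ℝ) * ((1 - 2 * P.α) * vMin P.G 1) ≤ P.T * (1 * V) := by gcongr
      _ = V * P.T := by ring
      _ < 2 ^ (m + 1) := h1'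
      _ = 2 * 1 * 2 ^ m := by ring
      _ ≤ P.lam * K * 2 ^ (2 * m) := by gcongr; linarith
  exact_mod_cast h3

theorem Admissible.len_pos [NeZero K] {P : Setup V K} (hP : P.Admissible) (hT : 1 ≤ P.T) (m : ℕ) :
    0 < P.len m := by
  obtain ⟨i⟩ := hP.connected.nonempty
  have hα := hP.one_sub_pos
  have hv : (0 : ℝ) < vMin P.G 1 := by exact_mod_cast vMin_pos P.G 1 i
  have hl := hP.lam_pos hT
  have hK : (1 : ℝ) ≤ K := by exact_mod_cast NeZero.one_le
  exact Nat.ceil_pos.mpr (by positivity)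

theorem Admissible.le_start [NeZero K] {P : Setup V K} (hP : P.Admissible) (hT : 1 ≤ P.T) :
    P.T ≤ P.start (Nat.log 2 (V * P.T) + 1) := by
  have := hP.lt_len hT le_rfl
  simp only [start]
  omega

theorem Admissible.natLog_le {P : Setup V K} (hP : P.Admissible) (hT : 1 ≤ P.T) :
    (Nat.log 2 (V * P.T) : ℝ) ≤ 2 * Real.log (V * P.T) := by
  have h := Real.natLog_le_logb (V * P.T) 2
  have h0 := Real.log_nonneg (hP.one_le_mul hT)
  have h2 := Real.log_two_gt_d9
  push_cast at h
  refine h.trans ?_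
  rw [Real.logb, div_le_iff₀ (by linarith)]
  nlinarith

/-- The communication cost is logarithmic in the horizon. -/
theorem Admissible.cost_le [NeZero K] {P : Setup V K} (hP : P.Admissible) (hT : 1 ≤ P.T) :
    (P.cost : ℝ) ≤ 2 * (V * Real.log (V * P.T)) := by
  classical
  -- Each epoch has one communication round, and it comes after the exploration rounds; once these
  -- outnumber `T`, it lies beyond the horizon.
  have h1 : ((Finset.range P.T).filter fun t => P.IsComm t).card ≤ Nat.log 2 (V * P.T) := by
    rw [← Finset.card_range (Nat.log 2 (V * P.T))]
    refine Finset.card_le_card_of_injOn P.epoch ?_ ?_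
    · intro t ht
      rw [Finset.mem_coe, Finset.mem_filter, Finset.mem_range, IsComm] at ht
      simp only [Finset.coe_range, Set.mem_Iio]
      by_contra! h
      have := hP.lt_len hT h
      omega
    · intro t ht s hs hts
      rw [Finset.mem_coe, Finset.mem_filter, IsComm] at ht hs
      rw [ht.2, hs.2, hts]
  have h2 : P.cost = V * ((Finset.range P.T).filter fun t => P.IsComm t).card := by
    rw [cost, Finset.sum_const, Finset.card_univ, Fintype.card_fin, smul_eq_mul,
      Finset.card_filter]
  have h3 : (((Finset.range P.T).filter fun t => P.IsComm t).card : ℝ) ≤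
      2 * Real.log (V * P.T) := le_trans (by exact_mod_cast h1) (hP.natLog_le hT)
  rw [h2]
  push_cast
  calc (V : ℝ) * _ ≤ V * (2 * Real.log (V * P.T)) := by gcongr
    _ = _ := by ring

end Setup

end DeMABAR

noncomputable section

namespace DeMABAR

namespace Setup

variable {V K : ℕ}

/-! ### Allocations -/

section Alloc

variable {P : Setup V K}

theorem Admissible.vLoc_mul_pos (hP : P.Admissible) (i : Fin V) :
    0 < (1 - 2 * P.α) * vLoc P.G 1 i :=
  mul_pos hP.one_sub_pos (by exact_mod_cast vLoc_pos P.G 1 i)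

theorem Admissible.vMin_mul_pos (hP : P.Admissible) :
    0 < (1 - 2 * P.α) * vMin P.G 1 := by
  obtain ⟨i⟩ := hP.connected.nonempty
  exact mul_pos hP.one_sub_pos (by exact_mod_cast vMin_pos P.G 1 i)

theorem Admissible.baseAlloc_nonneg (hP : P.Admissible) (hT : 1 ≤ P.T) (m : ℕ) (i : Fin V)
    (δ : ℝ) : 0 ≤ P.baseAlloc m i δ := by
  have h1 := hP.lam_pos hT
  have h2 := hP.vLoc_mul_pos i
  exact le_min (by positivity) (by positivity)

theorem sum_alloc (P : Setup V K) (m : ℕ) (i : Fin V) (Δ : Fin K → ℝ) :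
    ∑ k, P.alloc m i Δ k = P.len m := by
  classical
  rw [← Finset.add_sum_erase _ _ (Finset.mem_univ (P.lead m i Δ))]
  have h : ∑ k ∈ Finset.univ.erase (P.lead m i Δ), P.alloc m i Δ k =
      ∑ k ∈ Finset.univ.erase (P.lead m i Δ), P.baseAlloc m i (Δ k) :=
    Finset.sum_congr rfl fun k hk => by
      rw [alloc, if_neg (Finset.ne_of_mem_erase hk)]
  rw [h, alloc, if_pos rfl]
  simp

theorem alloc_of_ne (P : Setup V K) {m : ℕ} {i : Fin V} {Δ : Fin K → ℝ} {k : Fin K}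
    (hk : k ≠ P.lead m i Δ) : P.alloc m i Δ k = P.baseAlloc m i (Δ k) := by
  rw [alloc, if_neg hk]

/-- No arm gets less than its base allocation. -/
theorem Admissible.baseAlloc_le_alloc (hP : P.Admissible) (hT : 1 ≤ P.T) (m : ℕ) (i : Fin V)
    (Δ : Fin K → ℝ) (k : Fin K) : P.baseAlloc m i (Δ k) ≤ P.alloc m i Δ k := by
  classical
  by_cases hk : k = P.lead m i Δ
  · rw [alloc, if_pos hk]
    set b := P.lam * 2 ^ (2 * m) / ((1 - 2 * P.α) * vLoc P.G 1 i) with hb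
    have hle : ∀ l, P.baseAlloc m i (Δ l) ≤ b := fun l => min_le_right _ _
    have h1 := hP.lam_pos hT
    have h2 := hP.vLoc_mul_pos i
    have h3 := hP.vMin_mul_pos
    have h4 : ((vMin P.G 1 : ℕ) : ℝ) ≤ vLoc P.G 1 i := by exact_mod_cast vMin_le_vLoc P.G 1 i
    have h5 := hP.one_sub_pos
    -- Since `v_min ≤ v_i`, the epoch has room for all `K` arms at the maximal base allocation `b`;
    -- what the others leave to the leading arm therefore covers its own base allocation.
    have hlen : K * b ≤ P.len m := by
      refine le_trans ?_ (P.le_len m)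
      calc K * b = P.lam * K * 2 ^ (2 * m) / ((1 - 2 * P.α) * vLoc P.G 1 i) := by
            rw [hb]; ring
        _ ≤ P.lam * K * 2 ^ (2 * m) / ((1 - 2 * P.α) * vMin P.G 1) := by gcongr
    have hsum : ∑ l, P.baseAlloc m i (Δ l) ≤ K * b := by
      have := Finset.sum_le_card_nsmul Finset.univ (fun l => P.baseAlloc m i (Δ l)) b
        fun l _ => hle l
      simpa using this
    rw [← Finset.add_sum_erase _ _ (Finset.mem_univ (P.lead m i Δ)), ← hk] at hsum
    rw [← hk]
    linarith
  · rw [alloc_of_ne P hk]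

theorem Admissible.alloc_nonneg (hP : P.Admissible) (hT : 1 ≤ P.T) (m : ℕ) (i : Fin V)
    (Δ : Fin K → ℝ) (k : Fin K) : 0 ≤ P.alloc m i Δ k :=
  (hP.baseAlloc_nonneg hT m i _).trans (hP.baseAlloc_le_alloc hT m i Δ k)

/-- The number of pulls below which agent `i` discards a message about an arm with gap
estimate `δ`. -/
def threshold (P : Setup V K) (i : Fin V) (δ : ℝ) : ℝ :=
  P.lam * (δ ^ 2)⁻¹ / ((1 - 2 * P.α) * (nbhd P.G 1 i).card)

theorem Admissible.nbhd_mul_pos (hP : P.Admissible) (i : Fin V) :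
    0 < (1 - 2 * P.α) * (nbhd P.G 1 i).card :=
  mul_pos hP.one_sub_pos (by exact_mod_cast nbhd_card_pos P.G 1 i)

theorem Admissible.threshold_pos (hP : P.Admissible) (hT : 1 ≤ P.T) (i : Fin V) {δ : ℝ}
    (hδ : 0 < δ) : 0 < P.threshold i δ := by
  have h1 := hP.lam_pos hT
  have h2 := hP.nbhd_mul_pos i
  unfold threshold
  positivity

/-- Neighbours with comparable gap estimates pass the filter. -/
theorem Admissible.threshold_le_baseAlloc (hP : P.Admissible) (hT : 1 ≤ P.T) {m : ℕ} {i j : Fin V}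
    (hij : j ∈ nbhd P.G 1 i) {δ δ' : ℝ} (hδ : (1 / 2) ^ m ≤ δ) (hδ' : 0 < δ') (h : δ' ≤ 4 * δ) :
    P.threshold i δ ≤ P.baseAlloc m j δ' := by
  have h1 := hP.lam_pos hT
  have h2 := hP.vLoc_mul_pos j
  have h3 := hP.nbhd_mul_pos i
  have h4 : ((vLoc P.G 1 j : ℕ) : ℝ) ≤ (nbhd P.G 1 i).card := by
    exact_mod_cast vLoc_le_card P.G 1 ((mem_nbhd_comm P.G 1).mp hij)
  have h5 := hP.one_sub_pos
  have h6 : (0 : ℝ) < (1 / 2) ^ m := by positivity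
  have h7 : 0 < δ := h6.trans_le hδ
  refine le_min ?_ ?_
  -- The factor 16 in the allocation is the square of the factor 4 by which the two estimates may
  -- differ.
  · have : (δ ^ 2)⁻¹ ≤ 16 * (δ' ^ 2)⁻¹ := by
      rw [← div_eq_mul_inv, inv_eq_one_div, div_le_div_iff₀ (by positivity) (by positivity)]
      nlinarith
    rw [threshold]
    calc P.lam * (δ ^ 2)⁻¹ / ((1 - 2 * P.α) * (nbhd P.G 1 i).card)
        ≤ P.lam * (16 * (δ' ^ 2)⁻¹) / ((1 - 2 * P.α) * vLoc P.G 1 j) := by gcongr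
      _ = _ := by ring
  -- The cap on the allocation is harmless because no estimate in epoch `m` is finer than `2⁻ᵐ`.
  · have : (δ ^ 2)⁻¹ ≤ 2 ^ (2 * m) := by
      have h8 : ((1 / 2 : ℝ) ^ m) ^ 2 ≤ δ ^ 2 := by gcongr
      calc (δ ^ 2)⁻¹ ≤ (((1 / 2 : ℝ) ^ m) ^ 2)⁻¹ := by gcongr
        _ = 2 ^ (2 * m) := by
          rw [← pow_mul, mul_comm m 2, ← inv_pow]; norm_num
    rw [threshold]
    gcongr

end Alloc

/-! ### Gap estimates -/

section Gap

theorem le_iSup_fin (μ : Fin K → ℝ) (k : Fin K) : μ k ≤ ⨆ l, μ l :=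
  le_ciSup (Set.finite_range μ).bddAbove k

variable [NeZero K] {P : Setup V K}

theorem le_gap (P : Setup V K) (ξ : Path V K) (m : ℕ) (i : Fin V) (k : Fin K) :
    (1 / 2) ^ m ≤ P.gap ξ m i k := by
  cases m with
  | zero => simp [gap]
  | succ m => simp only [gap]; exact le_max_left _ _

theorem gap_pos (P : Setup V K) (ξ : Path V K) (m : ℕ) (i : Fin V) (k : Fin K) :
    0 < P.gap ξ m i k := lt_of_lt_of_le (by positivity) (P.le_gap ξ m i k)

/-- The leading arm attains the smallest possible gap estimate. -/
theorem Admissible.gap_lead (hP : P.Admissible) (ξ : Path V K) (m : ℕ) (i : Fin V) :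
    P.gap ξ m i (P.lead m i (P.gap ξ m i)) = (1 / 2) ^ m := by
  classical
  have hne : ∃ k, P.gap ξ m i k = (1 / 2) ^ m := by
    cases m with
    | zero => exact ⟨0, by simp [gap]⟩
    | succ m =>
      simp only [gap]
      set r : Fin K → ℝ := fun l =>
        P.estimate i (P.gap ξ m i l) (fun j => P.message m (P.gap ξ m) ξ j i) l with hr
      -- For the arm attaining `r_*`, the difference `r_* - r_l` is negative, so its new estimate is
      -- the floor value; hence some arm always qualifies.
      obtain ⟨l, hl⟩ := exists_eq_ciSup_of_finite (f := fun l => r l - P.gap ξ m i l / 8)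
      refine ⟨l, max_eq_left ?_⟩
      have h1 := P.gap_pos ξ m i l
      have h2 : (0 : ℝ) < (1 / 2) ^ (m + 1) := by positivity
      rw [← hl]
      linarith
  obtain ⟨k, hk⟩ := hne
  have := hP.sel_mem m i (Finset.univ.filter fun k => P.gap ξ m i k = (1 / 2) ^ m)
    ⟨k, by simp [hk]⟩
  rw [Finset.mem_filter] at this
  exact this.2

/-- In epoch `m`, the pooled empirical means of sufficiently many normal agents with sufficiently
many pulls are accurate. -/
def Accurate (P : Setup V K) (μ : Fin K → ℝ) (ξ : Path V K) (m : ℕ) : Prop :=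
  ∀ (i : Fin V) (k : Fin K) (W : Finset (Fin V)),
    (∀ j ∈ W, j ∉ P.byz ∧
      P.threshold i (P.gap ξ m i k) ≤ P.alloc m j (P.gap ξ m j) k) →
    (1 - 2 * P.α) * (nbhd P.G 1 i).card ≤ W.card → P.gap ξ m i k ≤ 4 →
    |∑ j ∈ W, (P.rewardSum m j (P.gap ξ m j) ξ k / P.alloc m j (P.gap ξ m j) k - μ k)| ≤
      W.card * (P.gap ξ m i k / 8)

/-- At the start of epoch `m`, all normal agents have gap estimates that are correct up to a
constant factor and the resolution `2⁻ᵐ`. -/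
def GapBounds (P : Setup V K) (μ : Fin K → ℝ) (ξ : Path V K) (m : ℕ) : Prop :=
  ∀ i ∉ P.byz, ∀ k,
    P.gap ξ m i k ≤ 8 / 7 * ((⨆ l, μ l) - μ k) + (1 / 2) ^ m ∧
    24 / 49 * ((⨆ l, μ l) - μ k) ≤ P.gap ξ m i k

theorem iSup_sub_le_one {μ : Fin K → ℝ} (hμ : ∀ k, μ k ∈ Set.Icc (0 : ℝ) 1) (k : Fin K) :
    (⨆ l, μ l) - μ k ≤ 1 := by
  have h1 : ⨆ l, μ l ≤ 1 := ciSup_le fun l => (hμ l).2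
  have h2 := (hμ k).1
  linarith

/-- With accurate pooled means and correct gap estimates, the filtered estimate of every arm is
accurate. -/
theorem Admissible.abs_estimate_sub_le (hP : P.Admissible) (hT : 1 ≤ P.T) {μ : Fin K → ℝ}
    (hμ : ∀ k, μ k ∈ Set.Icc (0 : ℝ) 1) {ξ : Path V K} {m : ℕ} (hacc : P.Accurate μ ξ m)
    (hgap : P.GapBounds μ ξ m) {i : Fin V} (hi : i ∉ P.byz) (k : Fin K) :
    |P.estimate i (P.gap ξ m i k) (fun j => P.message m (P.gap ξ m) ξ j i) k - μ k| ≤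
      P.gap ξ m i k / 8 := by
  classical
  set g := P.gap ξ m i k with hg
  set N := nbhd P.G 1 i with hN
  set msg : Fin V → Message K := fun j => P.message m (P.gap ξ m) ξ j i with hmsg
  have hpow1 : (1 / 2 : ℝ) ^ m ≤ 1 := pow_le_one₀ (by norm_num) (by norm_num)
  have hgi := hgap i hi k
  have hD1 := iSup_sub_le_one hμ k
  have hD0 := le_iSup_fin μ k
  have hg4 : g ≤ 4 := by linarith [hgi.1]
  have hgl : (1 / 2) ^ m ≤ g := P.le_gap ξ m i k
  have hNpos := hP.nbhd_mul_pos i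
  have hα0 := hP.alpha_nonneg
  -- all normal neighbours pass the filter
  have hpass : ∀ j ∈ N \ P.byz, P.threshold i g ≤ P.alloc m j (P.gap ξ m j) k := by
    intro j hj
    rw [Finset.mem_sdiff] at hj
    have hgj := hgap j hj.2 k
    refine (hP.threshold_le_baseAlloc hT hj.1 hgl (P.gap_pos ξ m j k) ?_).trans
      (hP.baseAlloc_le_alloc hT m j _ k)
    -- The estimate of `j` is at most `8/7 · 49/24 + 1 = 10/3` times that of `i`, below the factor 4
    -- that the filter tolerates.
    linarith [hgi.2, hgj.1]
  have hmsgn : ∀ j ∉ P.byz, msg j = (P.rewardSum m j (P.gap ξ m j) ξ, P.alloc m j (P.gap ξ m j)) :=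
    fun j hj => by simp only [hmsg, message, if_neg hj]
  set A := N.filter fun j => P.threshold i g ≤ (msg j).2 k with hA
  have hnA : N \ P.byz ⊆ A := by
    intro j hj
    have h1 := hpass j hj
    rw [Finset.mem_sdiff] at hj
    rw [hA, Finset.mem_filter]
    exact ⟨hj.1, by rw [hmsgn j hj.2]; exact h1⟩
  have hAN : A ⊆ N := Finset.filter_subset _ _
  have hb : ((P.byz ∩ N).card : ℝ) ≤ P.α * N.card := hP.byz_fraction i hi
  have hcN : (N \ P.byz).card + (P.byz ∩ N).card = N.card := by
    rw [Finset.inter_comm]; exact Finset.card_sdiff_add_card_inter N P.byz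
  have hcA : (N \ P.byz).card + (A \ (N \ P.byz)).card = A.card := by
    rw [add_comm]; exact Finset.card_sdiff_add_card_eq_card hnA
  have hAb : A \ (N \ P.byz) ⊆ P.byz ∩ N := by
    intro j hj
    rw [Finset.mem_sdiff, Finset.mem_sdiff] at hj
    rw [Finset.mem_inter]
    refine ⟨?_, hAN hj.1⟩
    by_contra h
    exact hj.2 ⟨hAN hj.1, h⟩
  have hcAb := Finset.card_le_card hAb
  have hcN' : ((N \ P.byz).card : ℝ) + (P.byz ∩ N).card = N.card := by exact_mod_cast hcN
  have hcA' : ((N \ P.byz).card : ℝ) + (A \ (N \ P.byz)).card = A.card := by exact_mod_cast hcA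
  have hcAb' : ((A \ (N \ P.byz)).card : ℝ) ≤ (P.byz ∩ N).card := by exact_mod_cast hcAb
  have hN0 : (0 : ℝ) ≤ N.card := Nat.cast_nonneg _
  have hAb0 : (0 : ℝ) ≤ (A \ (N \ P.byz)).card := Nat.cast_nonneg _
  -- `A` contains all normal neighbours, at least a fraction `1 - α`, so the filter is not reset.
  have hAge : (1 - 2 * P.α) * N.card ≤ A.card := by nlinarith
  set f := ⌊((A.card : ℝ) - (1 - 2 * P.α) * N.card) / 2⌋₊ with hf
  have hff : (f : ℝ) ≤ ((A.card : ℝ) - (1 - 2 * P.α) * N.card) / 2 :=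
    Nat.floor_le (by linarith)
  -- With `B` Byzantine neighbours, `b` of them in `A`, we have `|A| = |N| - B + b`. Thus `2b ≤ |A|
  -- - (1 - 2α)|N|` amounts to `b + B ≤ 2α|N|`, which holds because `b ≤ B ≤ α|N|`.
  have hfb : (A \ (N \ P.byz)).card ≤ f := Nat.le_floor (by nlinarith)
  have hf2 : 2 * f < A.card := by
    have : (2 : ℝ) * f < A.card := by linarith
    exact_mod_cast this
  have hest : P.estimate i g msg k =
      min (trimmedMean A f fun j => (msg j).1 k / (msg j).2 k) 1 := by
    simp only [estimate]
    rw [if_neg]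
    · rfl
    · exact not_lt.mpr hAge
  have hcard : ∀ W : Finset (Fin V), W.card = A.card - 2 * f →
      (1 - 2 * P.α) * N.card ≤ W.card := by
    intro W hW
    have : (W.card : ℝ) = A.card - 2 * f := by
      rw [hW, Nat.cast_sub hf2.le]; push_cast; ring
    rw [this]
    linarith
  have hpool : ∀ W ⊆ N \ P.byz, W.card = A.card - 2 * f →
      |(∑ j ∈ W, (msg j).1 k / (msg j).2 k) / W.card - μ k| ≤ g / 8 := by
    intro W hW hWc
    have h := hacc i k W (fun j hj => ⟨(Finset.mem_sdiff.mp (hW hj)).2, hpass j (hW hj)⟩)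
      (hcard W hWc) hg4
    have hW0 : (0 : ℝ) < W.card := hNpos.trans_le (hcard W hWc)
    have heq : ∑ j ∈ W, (P.rewardSum m j (P.gap ξ m j) ξ k / P.alloc m j (P.gap ξ m j) k - μ k) =
        W.card * ((∑ j ∈ W, (msg j).1 k / (msg j).2 k) / W.card - μ k) := by
      rw [Finset.sum_sub_distrib, Finset.sum_const, nsmul_eq_mul, mul_sub,
        mul_div_cancel₀ _ hW0.ne']
      congr 1
      exact Finset.sum_congr rfl fun j hj => by
        rw [hmsgn j (Finset.mem_sdiff.mp (hW hj)).2]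
    rw [heq, abs_mul, abs_of_pos hW0] at h
    exact le_of_mul_le_mul_left h hW0
  obtain ⟨W₁, hW₁, hc₁, hle₁⟩ := trimmedMean_le (fun j => (msg j).1 k / (msg j).2 k) hf2 hfb
  obtain ⟨W₂, hW₂, hc₂, hle₂⟩ := le_trimmedMean (fun j => (msg j).1 k / (msg j).2 k) hf2 hfb
  have h1 := abs_le.mp (hpool W₁ hW₁ hc₁)
  have h2 := abs_le.mp (hpool W₂ hW₂ hc₂)
  rw [hest, abs_le]
  have h3 := (hμ k).2
  constructor
  -- Capping the estimate at 1 does no harm because `μ k ≤ 1`.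
  · have : μ k - g / 8 ≤ min (trimmedMean A f fun j => (msg j).1 k / (msg j).2 k) 1 :=
      le_min (by linarith) (by linarith [P.gap_pos ξ m i k])
    linarith
  · have := min_le_left (trimmedMean A f fun j => (msg j).1 k / (msg j).2 k) 1
    linarith

/-- Correct gap estimates persist as long as the pooled means are accurate. -/
theorem Admissible.gapBounds_succ (hP : P.Admissible) (hT : 1 ≤ P.T) {μ : Fin K → ℝ}
    (hμ : ∀ k, μ k ∈ Set.Icc (0 : ℝ) 1) {ξ : Path V K} {m : ℕ} (hacc : P.Accurate μ ξ m)
    (hgap : P.GapBounds μ ξ m) : P.GapBounds μ ξ (m + 1) := by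
  intro i hi k
  set r : Fin K → ℝ := fun l =>
    P.estimate i (P.gap ξ m i l) (fun j => P.message m (P.gap ξ m) ξ j i) l with hr
  have hrl : ∀ l, |r l - μ l| ≤ P.gap ξ m i l / 8 := fun l =>
    hP.abs_estimate_sub_le hT hμ hacc hgap hi l
  have hdef : P.gap ξ (m + 1) i k =
      max ((1 / 2) ^ (m + 1)) ((⨆ l, (r l - P.gap ξ m i l / 8)) - r k) := rfl
  have hup : ⨆ l, (r l - P.gap ξ m i l / 8) ≤ ⨆ l, μ l := ciSup_le fun l => by
    have := (abs_le.mp (hrl l)).2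
    have := le_iSup_fin μ l
    linarith
  obtain ⟨b, hb⟩ := exists_eq_ciSup_of_finite (f := μ)
  -- An optimal arm `b` has estimate at most `2⁻ᵐ`; one eighth of it is lost to the error and one to
  -- the penalty.
  have hlow : (⨆ l, μ l) - 1 / 4 * (1 / 2) ^ m ≤ ⨆ l, (r l - P.gap ξ m i l / 8) := by
    refine le_trans ?_ (le_iSup_fin (fun l => r l - P.gap ξ m i l / 8) b)
    have h1 := (abs_le.mp (hrl b)).1
    have h2 := (hgap i hi b).1
    rw [hb] at h1 h2
    linarith
  have hk := abs_le.mp (hrl k)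
  have hgk := hgap i hi k
  have hD0 := le_iSup_fin μ k
  have hp : (0 : ℝ) < (1 / 2) ^ m := by positivity
  have hps : (1 / 2 : ℝ) ^ (m + 1) = (1 / 2) ^ m / 2 := by rw [pow_succ]; ring
  constructor
  · rw [hdef, hps]
    -- The constant `8/7` solves `c = 1 + c/8`: the new estimate is at most the gap plus an eighth
    -- of the old one.
    refine max_le (by linarith) (by linarith)
  · have h1 : (1 / 2) ^ m / 2 ≤ P.gap ξ (m + 1) i k := by
      rw [hdef, hps]; exact le_max_left _ _
    have h2 : (⨆ l, (r l - P.gap ξ m i l / 8)) - r k ≤ P.gap ξ (m + 1) i k := by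
      rw [hdef]; exact le_max_right _ _
    -- The new estimate `g'` is at least `6/7 Δ_k - 3/8 · 2⁻ᵐ`. Since also `2⁻ᵐ ≤ 2 g'`, this gives
    -- `7/4 g' ≥ 6/7 Δ_k`, which is where `24/49` comes from.
    linarith

/-- Induction over the epochs. The start is trivial, as all estimates are 1 and all gaps lie in `[0,
1]`. Estimates for epoch `m` use samples of earlier epochs only. -/
theorem Admissible.gapBounds (hP : P.Admissible) (hT : 1 ≤ P.T) {μ : Fin K → ℝ}
    (hμ : ∀ k, μ k ∈ Set.Icc (0 : ℝ) 1) {ξ : Path V K} {m : ℕ}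
    (hacc : ∀ m' < m, P.Accurate μ ξ m') : P.GapBounds μ ξ m := by
  induction m with
  | zero =>
    intro i _ k
    have h1 := iSup_sub_le_one hμ k
    have h2 := le_iSup_fin μ k
    simp only [gap, pow_zero]
    constructor <;> linarith
  | succ m ih =>
    exact hP.gapBounds_succ hT hμ (hacc m (by omega)) (ih fun m' h => hacc m' (by omega))

end Gap

end Setup

end DeMABAR

end

namespace DeMABAR

/-! ### Measurability of the algorithm -/

/-- The drawn arm is a function of a random finite set, whose fibres are measurable. -/
theorem measurable_draw {Ω : Type*} [MeasurableSpace Ω] {K : ℕ} [NeZero K] {p : Ω → Fin K → ℝ}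
    {u : Ω → ℝ} (hp : ∀ k, Measurable fun ω => p ω k) (hu : Measurable u) :
    Measurable fun ω => draw (p ω) (u ω) := by
  classical
  refine measurable_of_fibres
    (F := fun ω => Finset.univ.filter fun k => u ω < ∑ l ∈ Finset.Iic k, p ω l)
    (g := fun S _ => if h : S.Nonempty then S.min' h else 0) ?_ (fun _ => measurable_const)
  refine measurableSet_fibre_finset fun k => ?_
  simp only [Finset.mem_filter, Finset.mem_univ, true_and]
  exact measurableSet_lt hu (Finset.measurable_sum _ fun l _ => hp l)

namespace Setup

variable {V K : ℕ} (P : Setup V K) {Ω : Type*} [MeasurableSpace Ω]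

/-- The arbitrary tie-breaking rule sees only the finite set of qualifying arms, so no regularity of
the rule is needed. -/
theorem measurable_lead (m : ℕ) (i : Fin V) {D : Ω → Fin K → ℝ}
    (hD : ∀ k, Measurable fun ω => D ω k) : Measurable fun ω => P.lead m i (D ω) := by
  classical
  refine measurable_of_fibres
    (F := fun ω => Finset.univ.filter fun k => D ω k = (1 / 2) ^ m)
    (g := fun S _ => P.sel m i S) ?_ (fun _ => measurable_const)
  refine measurableSet_fibre_finset fun k => ?_
  simp only [Finset.mem_filter, Finset.mem_univ, true_and]
  exact measurableSet_eq_fun (hD k) measurable_const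

theorem measurable_baseAlloc (m : ℕ) (i : Fin V) : Measurable (P.baseAlloc m i) := by
  unfold baseAlloc
  fun_prop

theorem measurable_alloc (m : ℕ) (i : Fin V) {D : Ω → Fin K → ℝ}
    (hD : ∀ k, Measurable fun ω => D ω k) (k : Fin K) :
    Measurable fun ω => P.alloc m i (D ω) k := by
  classical
  refine measurable_of_fibres (F := fun ω => P.lead m i (D ω))
    (g := fun a ω => if k = a then P.len m - ∑ l ∈ Finset.univ.erase a, P.baseAlloc m i (D ω l)
      else P.baseAlloc m i (D ω k))
    (fun a => P.measurable_lead m i hD (measurableSet_singleton a)) fun a => ?_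
  have hb : ∀ l, Measurable fun ω => P.baseAlloc m i (D ω l) := fun l =>
    (P.measurable_baseAlloc m i).comp (hD l)
  split_ifs
  · exact measurable_const.sub (Finset.measurable_sum _ fun l _ => hb l)
  · exact hb k

theorem measurable_explore [NeZero K] (m : ℕ) (i : Fin V) {D : Ω → Fin K → ℝ}
    (hD : ∀ k, Measurable fun ω => D ω k) {u : Ω → ℝ} (hu : Measurable u) :
    Measurable fun ω => P.explore m i (D ω) (u ω) :=
  measurable_draw (fun k => (P.measurable_alloc m i hD k).div_const _) hu

theorem measurable_rewardSum [NeZero K] (m : ℕ) (i : Fin V) {D : Ω → Fin K → ℝ}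
    (hD : ∀ k, Measurable fun ω => D ω k) {ξ : Ω → Path V K}
    (hu : ∀ t < P.start (m + 1), Measurable fun ω => (ξ ω).u t i)
    (hx : ∀ t < P.start (m + 1), Measurable fun ω => (ξ ω).x t i) (k : Fin K) :
    Measurable fun ω => P.rewardSum m i (D ω) (ξ ω) k := by
  unfold rewardSum
  refine Finset.measurable_sum _ fun t ht => ?_
  have ht' : t < P.start (m + 1) := by
    rw [Finset.mem_Ico] at ht
    simp only [start]
    omega
  exact Measurable.ite (P.measurable_explore m i hD (hu t ht') (measurableSet_singleton k))
    ((measurable_pi_apply k).comp (hx t ht')) measurable_const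

theorem measurable_estimate (i : Fin V) {δ : Ω → ℝ} (hδ : Measurable δ)
    {msg : Ω → Fin V → Message K} (k : Fin K) (h1 : ∀ j, Measurable fun ω => (msg ω j).1 k)
    (h2 : ∀ j, Measurable fun ω => (msg ω j).2 k) :
    Measurable fun ω => P.estimate i (δ ω) (msg ω) k := by
  classical
  refine measurable_of_fibres
    (F := fun ω => (nbhd P.G 1 i).filter fun j => P.threshold i (δ ω) ≤ (msg ω j).2 k)
    (g := fun S ω =>
      let A := if (S.card : ℝ) < (1 - 2 * P.α) * (nbhd P.G 1 i).card then nbhd P.G 1 i else S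
      let f := ⌊((A.card : ℝ) - (1 - 2 * P.α) * (nbhd P.G 1 i).card) / 2⌋₊
      min (trimmedMean A f fun j => (msg ω j).1 k / (msg ω j).2 k) 1) ?_ fun S => ?_
  · refine measurableSet_fibre_finset fun j => ?_
    simp only [Finset.mem_filter]
    have hth : Measurable fun ω => P.threshold i (δ ω) := by
      unfold threshold
      fun_prop
    exact (MeasurableSet.const _).inter (measurableSet_le hth (h2 j))
  · exact ((measurable_trimmedMean _ _).comp
      (measurable_pi_lambda _ fun j => (h1 j).div (h2 j))).min measurable_const

/-- The gap estimates of epoch `m` depend only on what happened before. -/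
theorem measurable_gap [NeZero K] {ξ : Ω → Path V K} (m : ℕ)
    (hu : ∀ t < P.start m, ∀ i, Measurable fun ω => (ξ ω).u t i)
    (hx : ∀ t < P.start m, ∀ i, Measurable fun ω => (ξ ω).x t i)
    (hz : ∀ l < m, ∀ j i, Measurable fun ω => (ξ ω).z l j i) (i : Fin V) (k : Fin K) :
    Measurable fun ω => P.gap (ξ ω) m i k := by
  induction m generalizing i k with
  | zero => simp only [gap]; exact measurable_const
  | succ m ih =>
    have hlt : P.start m < P.start (m + 1) := P.start_strictMono (Nat.lt_succ_self m)
    have ih' := ih (fun t ht => hu t (ht.trans hlt)) (fun t ht => hx t (ht.trans hlt))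
      (fun l hl => hz l (by omega))
    have hm1 : ∀ j l, Measurable fun ω => (P.message m (P.gap (ξ ω) m) (ξ ω) j i).1 l := by
      intro j l
      by_cases hj : j ∈ P.byz
      · simp only [message, if_pos hj]
        exact (measurable_pi_apply l).comp (hz m (by omega) j i).fst
      · simp only [message, if_neg hj]
        exact P.measurable_rewardSum m j (ih' j) (fun t ht => hu t ht j) (fun t ht => hx t ht j) l
    have hm2 : ∀ j l, Measurable fun ω => (P.message m (P.gap (ξ ω) m) (ξ ω) j i).2 l := by
      intro j l
      by_cases hj : j ∈ P.byz
      · simp only [message, if_pos hj]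
        exact (measurable_pi_apply l).comp (hz m (by omega) j i).snd
      · simp only [message, if_neg hj]
        exact P.measurable_alloc m j (ih' j) l
    have hr : ∀ l, Measurable fun ω =>
        P.estimate i (P.gap (ξ ω) m i l) (fun j => P.message m (P.gap (ξ ω) m) (ξ ω) j i) l :=
      fun l => P.measurable_estimate i (ih' i l) l (fun j => hm1 j l) (fun j => hm2 j l)
    simp only [gap]
    refine measurable_const.max (Measurable.sub ?_ (hr k))
    exact Measurable.iSup fun l => (hr l).sub ((ih' i l).div_const 8)

variable {P} {ν : Fin K → Measure ℝ}

/-- The seeds and rewards of one round. -/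
abbrev Round (V K : ℕ) := Fin V → ℝ × (Fin K → ℝ)

/-- All samples and messages entering the estimates, Byzantine ones included, are known before epoch
`m` begins. The samples of epoch `m` are thus fresh. -/
theorem Environment.measurable_gap [NeZero K] {Q : Measure Ω} (E : P.Environment ν Q) (m : ℕ)
    (i : Fin V) (k : Fin K) :
    Measurable[E.ℱ (P.start m)] fun ω => P.gap (E.path ω) m i k := by
  refine @Setup.measurable_gap V K P Ω (E.ℱ (P.start m)) _ E.path m ?_ ?_ ?_ i k
  · exact fun t ht i => (E.measurable_u t i).mono (E.ℱ.mono ht) le_rfl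
  · exact fun t ht i => (E.measurable_x t i).mono (E.ℱ.mono ht) le_rfl
  · exact fun l hl j i => (E.measurable_z l j i).mono
      (E.ℱ.mono (P.start_strictMono.monotone hl)) le_rfl

/-- The seeds and rewards of round `t`, as a random variable. -/
def Environment.round {Q : Measure Ω} (E : P.Environment ν Q) (t : ℕ) (ω : Ω) : Round V K :=
  fun i => ((E.path ω).u t i, (E.path ω).x t i)

theorem Environment.measurable_round {Q : Measure Ω} (E : P.Environment ν Q) (t : ℕ) :
    Measurable[E.ℱ (t + 1)] (E.round t) :=
  @measurable_pi_lambda Ω _ _ (E.ℱ (t + 1)) _ _ fun i =>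
    (E.measurable_u t i).prodMk (E.measurable_x t i)

end Setup

end DeMABAR

noncomputable section

namespace DeMABAR

/-! ### Drawing by inversion -/

section Law

variable {K : ℕ} {ν : Fin K → Measure ℝ} [hν : ∀ k, IsProbabilityMeasure (ν k)]

instance : IsProbabilityMeasure (volume.restrict (Set.Icc (0 : ℝ) 1)) := ⟨by simp⟩

/-- The joint law of the seed and the reward vector of one agent in one round. -/
abbrev agentLaw (ν : Fin K → Measure ℝ) : Measure (ℝ × (Fin K → ℝ)) :=
  (volume.restrict (Set.Icc (0 : ℝ) 1)).prod (Measure.pi ν)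

theorem ae_agentLaw (h01 : ∀ k, ∀ᵐ y ∂(ν k), y ∈ Set.Icc (0 : ℝ) 1) :
    ∀ᵐ y ∂(agentLaw ν), ∀ k, y.2 k ∈ Set.Icc (0 : ℝ) 1 := by
  refine ae_all_iff.mpr fun k => ?_
  have h1 : ∀ᵐ x ∂(Measure.pi ν), x k ∈ Set.Icc (0 : ℝ) 1 :=
    (measurePreserving_eval ν k).quasiMeasurePreserving.ae (h01 k)
  exact Measure.quasiMeasurePreserving_snd.ae h1

theorem mean_mem (h01 : ∀ k, ∀ᵐ y ∂(ν k), y ∈ Set.Icc (0 : ℝ) 1) (k : Fin K) :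
    mean ν k ∈ Set.Icc (0 : ℝ) 1 := by
  have hint : Integrable (fun y : ℝ => y) (ν k) := by
    refine Integrable.of_bound measurable_id.aestronglyMeasurable 1 ?_
    filter_upwards [h01 k] with y hy
    rw [Real.norm_eq_abs, abs_of_nonneg hy.1]
    exact hy.2
  constructor
  · exact integral_nonneg_of_ae ((h01 k).mono fun y hy => hy.1)
  · calc mean ν k ≤ ∫ _, (1 : ℝ) ∂(ν k) :=
        integral_mono_ae hint (integrable_const _) ((h01 k).mono fun y hy => hy.2)
      _ = 1 := by simp

end Law

section Draw

variable {K : ℕ} [NeZero K]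

/-- The cumulative sums cut `[0, 1)` into consecutive intervals, one per arm. The seed 1 is excluded
because no cumulative sum exceeds it. -/
theorem draw_eq_iff {p : Fin K → ℝ} (hp : ∀ k, 0 ≤ p k) (hsum : ∑ k, p k = 1) {u : ℝ}
    (hu : u ∈ Set.Ico (0 : ℝ) 1) (k : Fin K) :
    draw p u = k ↔ u ∈ Set.Ico (∑ l ∈ Finset.Iio k, p l) (∑ l ∈ Finset.Iic k, p l) := by
  classical
  have hne : (Finset.univ.filter fun k => u < ∑ l ∈ Finset.Iic k, p l).Nonempty := by
    refine ⟨⊤, ?_⟩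
    simp [hsum, hu.2]
  have hmono : ∀ l, l < k → ∑ a ∈ Finset.Iic l, p a ≤ ∑ a ∈ Finset.Iio k, p a := fun l hl =>
    Finset.sum_le_sum_of_subset_of_nonneg
      (fun a ha => Finset.mem_Iio.mpr ((Finset.mem_Iic.mp ha).trans_lt hl)) fun a _ _ => hp a
  have hdraw : draw p u = (Finset.univ.filter fun k => u < ∑ l ∈ Finset.Iic k, p l).min' hne := by
    unfold draw
    rw [dif_pos hne]
  rw [hdraw]
  constructor
  · intro h
    have hmem := Finset.min'_mem _ hne
    rw [h, Finset.mem_filter] at hmem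
    refine ⟨?_, hmem.2⟩
    rcases (Finset.Iio k).eq_empty_or_nonempty with he | hne'
    · rw [he, Finset.sum_empty]; exact hu.1
    · set b := (Finset.Iio k).max' hne' with hb
      have hbk : b < k := Finset.mem_Iio.mp (Finset.max'_mem _ hne')
      have hIio : Finset.Iio k = Finset.Iic b := by
        ext a
        simp only [Finset.mem_Iio, Finset.mem_Iic]
        exact ⟨fun ha => Finset.le_max' _ _ (Finset.mem_Iio.mpr ha), fun ha => ha.trans_lt hbk⟩
      rw [hIio]
      by_contra! hlt
      have := Finset.min'_le (Finset.univ.filter fun k => u < ∑ l ∈ Finset.Iic k, p l) b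
        (by simp [hlt])
      rw [h] at this
      exact absurd hbk (not_lt.mpr this)
  · rintro ⟨h1, h2⟩
    refine le_antisymm (Finset.min'_le _ _ (by simp [h2])) ?_
    refine Finset.le_min' _ _ _ fun l hl => ?_
    by_contra! hlk
    rw [Finset.mem_filter] at hl
    linarith [hmono l hlk, hl.2]

/-- Inversion draws an arm with its probability. -/
theorem integral_draw {p : Fin K → ℝ} (hp : ∀ k, 0 ≤ p k) (hsum : ∑ k, p k = 1) (k : Fin K) :
    ∫ u in Set.Icc (0 : ℝ) 1, (if draw p u = k then (1 : ℝ) else 0) = p k := by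
  set a := ∑ l ∈ Finset.Iio k, p l with ha
  set b := ∑ l ∈ Finset.Iic k, p l with hb
  have hab : b = a + p k := by
    rw [ha, hb, ← Finset.Iio_insert, Finset.sum_insert (by simp), add_comm]
  have ha0 : 0 ≤ a := Finset.sum_nonneg fun l _ => hp l
  have hb1 : b ≤ 1 := by
    rw [← hsum]
    exact Finset.sum_le_sum_of_subset_of_nonneg (Finset.subset_univ _) fun l _ _ => hp l
  rw [integral_Icc_eq_integral_Ico]
  have h1 : ∫ u in Set.Ico (0 : ℝ) 1, (if draw p u = k then (1 : ℝ) else 0) =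
      ∫ u in Set.Ico (0 : ℝ) 1, (Set.Ico a b).indicator (fun _ => (1 : ℝ)) u := by
    refine setIntegral_congr_fun measurableSet_Ico fun u hu => ?_
    simp only [Set.indicator_apply, draw_eq_iff hp hsum hu, ha, hb]
  rw [h1, setIntegral_indicator measurableSet_Ico,
    Set.inter_eq_self_of_subset_right (Set.Ico_subset_Ico ha0 hb1)]
  simp [hab, hp k]

/-- The reward from arm `k` for an agent that draws its arm from `p`. -/
def gain (p : Fin K → ℝ) (k : Fin K) (y : ℝ × (Fin K → ℝ)) : ℝ :=
  if draw p y.1 = k then y.2 k else 0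

theorem measurable_gain (p : Fin K → ℝ) (k : Fin K) : Measurable (gain p k) := by
  have hd : Measurable fun y : ℝ × (Fin K → ℝ) => draw p y.1 :=
    measurable_draw (p := fun _ => p) (fun _ => measurable_const) measurable_fst
  have hs : MeasurableSet {y : ℝ × (Fin K → ℝ) | draw p y.1 = k} := hd (measurableSet_singleton k)
  exact Measurable.ite hs ((measurable_pi_apply k).comp measurable_snd) measurable_const

theorem gain_mem {p : Fin K → ℝ} {k : Fin K} {y : ℝ × (Fin K → ℝ)}
    (hy : ∀ k, y.2 k ∈ Set.Icc (0 : ℝ) 1) : gain p k y ∈ Set.Icc (0 : ℝ) 1 := by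
  unfold gain
  split_ifs
  · exact hy k
  · simp

variable {ν : Fin K → Measure ℝ} [hν : ∀ k, IsProbabilityMeasure (ν k)]

theorem integrable_gain (h01 : ∀ k, ∀ᵐ y ∂(ν k), y ∈ Set.Icc (0 : ℝ) 1) (p : Fin K → ℝ)
    (k : Fin K) : Integrable (gain p k) (agentLaw ν) := by
  refine Integrable.of_bound (measurable_gain p k).aestronglyMeasurable 1 ?_
  filter_upwards [ae_agentLaw h01] with y hy
  have := gain_mem (p := p) (k := k) hy
  rw [Real.norm_eq_abs, abs_of_nonneg this.1]
  exact this.2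

theorem integral_gain {p : Fin K → ℝ} (hp : ∀ k, 0 ≤ p k) (hsum : ∑ k, p k = 1) (k : Fin K) :
    ∫ y, gain p k y ∂(agentLaw ν) = p k * mean ν k := by
  have h1 : ∀ y : ℝ × (Fin K → ℝ), gain p k y =
      (if draw p y.1 = k then (1 : ℝ) else 0) * y.2 k := fun y => by
    unfold gain; split_ifs <;> simp
  simp_rw [h1]
  rw [integral_prod_mul (fun u => if draw p u = k then (1 : ℝ) else 0) fun x : Fin K → ℝ => x k,
    integral_draw hp hsum, integral_eval, mean]

theorem integrable_exp_gain (h01 : ∀ k, ∀ᵐ y ∂(ν k), y ∈ Set.Icc (0 : ℝ) 1) (p : Fin K → ℝ)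
    (k : Fin K) (a : ℝ) : Integrable (fun y => Real.exp (a * gain p k y)) (agentLaw ν) := by
  refine Integrable.of_bound
    (((measurable_gain p k).const_mul a).exp).aestronglyMeasurable (Real.exp |a|) ?_
  filter_upwards [ae_agentLaw h01] with y hy
  have := gain_mem (p := p) (k := k) hy
  rw [Real.norm_eq_abs, Real.abs_exp, Real.exp_le_exp]
  calc a * gain p k y ≤ |a| * gain p k y := by gcongr; exacts [this.1, le_abs_self a]
    _ ≤ |a| * 1 := by gcongr; exact this.2
    _ = |a| := mul_one _

/-- A Bernstein bound for the exponential moments of the reward from one arm. -/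
theorem integral_exp_gain_le (h01 : ∀ k, ∀ᵐ y ∂(ν k), y ∈ Set.Icc (0 : ℝ) 1) {p : Fin K → ℝ}
    (hp : ∀ k, 0 ≤ p k) (hsum : ∑ k, p k = 1) (k : Fin K) {a : ℝ} (ha : |a| ≤ 1) :
    ∫ y, Real.exp (a * gain p k y) ∂(agentLaw ν) ≤
      Real.exp (a * (p k * mean ν k) + a ^ 2 * p k) := by
  have hg := integrable_gain h01 p k
  calc ∫ y, Real.exp (a * gain p k y) ∂(agentLaw ν)
      ≤ ∫ y, (1 + (a * gain p k y + a ^ 2 * gain p k y)) ∂(agentLaw ν) := by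
        refine integral_mono_ae (integrable_exp_gain h01 p k a)
          -- The pointwise bound is `exp x ≤ 1 + x + x²` for `|x| ≤ 1`, with `X² ≤ X` for `X` in
          -- `[0, 1]`; this makes the variance term proportional to `p k`.
          ((integrable_const _).add ((hg.const_mul _).add (hg.const_mul _))) ?_
        filter_upwards [ae_agentLaw h01] with y hy
        have hX := gain_mem (p := p) (k := k) hy
        have h1 : |a * gain p k y| ≤ 1 := by
          rw [abs_mul, abs_of_nonneg hX.1]
          exact mul_le_one₀ ha hX.1 hX.2
        have h2 := (abs_le.mp (Real.abs_exp_sub_one_sub_id_le h1)).2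
        have h3 : (a * gain p k y) ^ 2 ≤ a ^ 2 * gain p k y := by
          rw [mul_pow]
          gcongr
          nlinarith [hX.1, hX.2]
        linarith
    _ = 1 + (a * (p k * mean ν k) + a ^ 2 * (p k * mean ν k)) := by
        have h2 : Integrable (fun y => a * gain p k y + a ^ 2 * gain p k y) (agentLaw ν) :=
          (hg.const_mul _).add (hg.const_mul _)
        rw [integral_add (integrable_const _) h2,
          integral_add (hg.const_mul _) (hg.const_mul _), integral_const_mul, integral_const_mul,
          integral_gain hp hsum]
        simp
    _ ≤ 1 + (a * (p k * mean ν k) + a ^ 2 * p k) := by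
        gcongr
        exact mul_le_of_le_one_right (hp k) (mean_mem h01 k).2
    _ ≤ _ := by
        rw [add_comm]
        exact Real.add_one_le_exp _

end Draw

/-! ### Exponential supermartingales -/

section Freeze

/-- Freezing: the past `X` may be held fixed while integrating over the independent `Z`, by Fubini
for the product law. -/
theorem lintegral_indepFun {Ω α β : Type*} [MeasurableSpace Ω] [MeasurableSpace α]
    [MeasurableSpace β] {Q : Measure Ω} [IsProbabilityMeasure Q] {X : Ω → α} {Z : Ω → β}
    (hX : Measurable X) (hZ : Measurable Z) (h : IndepFun X Z Q) {F : α × β → ENNReal}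
    (hF : Measurable F) :
    ∫⁻ ω, F (X ω, Z ω) ∂Q = ∫⁻ ω, ∫⁻ z, F (X ω, z) ∂(Q.map Z) ∂Q := by
  have := Measure.isProbabilityMeasure_map (μ := Q) hZ.aemeasurable
  rw [← lintegral_map (f := F) hF (hX.prodMk hZ),
    h.map_prod_eq_prod_map_map hX.aemeasurable hZ.aemeasurable, lintegral_prod _ hF.aemeasurable,
    lintegral_map hF.lintegral_prod_right' hX]

theorem integral_indepFun {Ω α β : Type*} [MeasurableSpace Ω] [MeasurableSpace α]
    [MeasurableSpace β] {Q : Measure Ω} [IsProbabilityMeasure Q] {X : Ω → α} {Z : Ω → β}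
    (hX : Measurable X) (hZ : Measurable Z) (h : IndepFun X Z Q) {F : α × β → ℝ}
    (hF : Measurable F) (hint : Integrable (fun ω => F (X ω, Z ω)) Q) :
    ∫ ω, F (X ω, Z ω) ∂Q = ∫ ω, ∫ z, F (X ω, z) ∂(Q.map Z) ∂Q := by
  have := Measure.isProbabilityMeasure_map (μ := Q) hZ.aemeasurable
  have := Measure.isProbabilityMeasure_map (μ := Q) hX.aemeasurable
  have hmap := h.map_prod_eq_prod_map_map hX.aemeasurable hZ.aemeasurable
  have hint' : Integrable F ((Q.map X).prod (Q.map Z)) := by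
    rw [← hmap, integrable_map_measure hF.aestronglyMeasurable (hX.prodMk hZ).aemeasurable]
    exact hint
  rw [← integral_map (f := F) (hX.prodMk hZ).aemeasurable hF.aestronglyMeasurable, hmap,
    integral_prod _ hint', integral_map hX.aemeasurable]
  exact hF.stronglyMeasurable.integral_prod_right'.aestronglyMeasurable

variable {Ω β : Type*} {mΩ : MeasurableSpace Ω} [mβ : MeasurableSpace β] {Q : Measure Ω}

/-- Taking the whole past to be the identity into `Ω` with the smaller σ-algebra lets freezing apply
to anything measurable with respect to the past. -/
theorem indepFun_id_of_indep {m : MeasurableSpace Ω} {Z : Ω → β} (h : Indep m (mβ.comap Z) Q) :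
    @IndepFun Ω Ω β mΩ m mβ id Z Q := by
  rw [@IndepFun_iff_Indep Ω Ω β mΩ m mβ, MeasurableSpace.comap_id]
  exact h

theorem measurable_prod_rounds (ℱ : Filtration ℕ mΩ) {Z : ℕ → Ω → β}
    (hZ : ∀ t, Measurable[ℱ (t + 1)] (Z t)) {s : ℕ} {B : Set Ω} (hB : MeasurableSet[ℱ s] B)
    {H : Ω × β → ENNReal} (hH : @Measurable (Ω × β) ENNReal ((ℱ s).prod mβ) _ H) (n : ℕ) :
    Measurable[ℱ (s + n)] fun ω =>
      B.indicator (1 : Ω → ENNReal) ω * ∏ t ∈ Finset.Ico s (s + n), H (ω, Z t ω) := by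
  have hle : ℱ s ≤ ℱ (s + n) := ℱ.mono (by omega)
  have hH' : @Measurable (Ω × β) ENNReal ((ℱ (s + n)).prod mβ) _ H :=
    hH.mono (sup_le_sup (MeasurableSpace.comap_mono hle) le_rfl) le_rfl
  refine Measurable.mul ?_ ?_
  · have h1 : Measurable[ℱ s] fun _ : Ω => (1 : ENNReal) := measurable_const
    exact (h1.indicator hB).mono hle le_rfl
  · refine Finset.measurable_prod _ fun t ht => ?_
    rw [Finset.mem_Ico] at ht
    refine hH'.comp ?_
    exact (@measurable_id Ω (ℱ (s + n))).prodMk ((hZ t).mono (ℱ.mono (by omega)) le_rfl)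

/-- A product of functions of independent rounds, with conditional means at most one given the
start, has mean at most one. -/
theorem lintegral_prod_rounds_le_one [IsProbabilityMeasure Q] (ℱ : Filtration ℕ mΩ)
    {Z : ℕ → Ω → β} (hZ : ∀ t, Measurable[ℱ (t + 1)] (Z t))
    (hind : ∀ t, Indep (ℱ t) (mβ.comap (Z t)) Q) {π : Measure β} (hlaw : ∀ t, Q.map (Z t) = π)
    {s : ℕ} {B : Set Ω} (hB : MeasurableSet[ℱ s] B) {H : Ω × β → ENNReal}
    (hH : @Measurable (Ω × β) ENNReal ((ℱ s).prod mβ) _ H)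
    (hH1 : ∀ ω ∈ B, ∫⁻ z, H (ω, z) ∂π ≤ 1) (n : ℕ) :
    ∫⁻ ω, B.indicator 1 ω * ∏ t ∈ Finset.Ico s (s + n), H (ω, Z t ω) ∂Q ≤ 1 := by
  induction n with
  | zero =>
    simp only [add_zero, Finset.Ico_self, Finset.prod_empty, mul_one]
    rw [lintegral_indicator_one (ℱ.le s _ hB)]
    exact prob_le_one
  | succ n ih =>
    have hle : ℱ s ≤ ℱ (s + n) := ℱ.mono (by omega)
    have hH' : @Measurable (Ω × β) ENNReal ((ℱ (s + n)).prod mβ) _ H :=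
      hH.mono (sup_le_sup (MeasurableSpace.comap_mono hle) le_rfl) le_rfl
    have hΦ := measurable_prod_rounds ℱ hZ hB hH n
    have hF : @Measurable (Ω × β) ENNReal ((ℱ (s + n)).prod mβ) _ fun q =>
        (B.indicator (1 : Ω → ENNReal) q.1 * ∏ t ∈ Finset.Ico s (s + n), H (q.1, Z t q.1)) *
          H q :=
      Measurable.mul (hΦ.comp (@measurable_fst Ω β (ℱ (s + n)) mβ)) hH'
    -- The last round is integrated out while everything before it, and the dependence of `H` on the
    -- past, stays frozen.
    have hfr := @lintegral_indepFun Ω Ω β mΩ (ℱ (s + n)) mβ Q _ id (Z (s + n))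
      (measurable_id'' (ℱ.le _)) ((hZ _).mono (ℱ.le _) le_rfl) (indepFun_id_of_indep (hind _)) _ hF
    refine le_trans (le_of_eq ?_) ((le_of_eq hfr).trans (le_trans ?_ ih))
    · refine lintegral_congr fun ω => ?_
      rw [← add_assoc, Finset.prod_Ico_succ_top (by omega), ← mul_assoc]
      rfl
    · refine lintegral_mono fun ω => ?_
      simp only [id, hlaw]
      by_cases hω : ω ∈ B
      · have hHω : Measurable fun z => H (ω, z) :=
          hH'.comp (@measurable_prodMk_left Ω β (ℱ (s + n)) mβ ω)
        rw [lintegral_const_mul _ hHω]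
        exact mul_le_of_le_one_right' (hH1 ω hω)
      · simp [hω]

end Freeze

end DeMABAR

end

noncomputable section

namespace DeMABAR

/-! ### Concentration of the pooled means -/

section Tilt

variable {V K : ℕ} [NeZero K] {ν : Fin K → Measure ℝ} [hν : ∀ k, IsProbabilityMeasure (ν k)]

/-- The exponentially tilted rewards of the agents in `W` have mean at most one. -/
theorem lintegral_tilt_le_one (h01 : ∀ k, ∀ᵐ y ∂(ν k), y ∈ Set.Icc (0 : ℝ) 1)
    (W : Finset (Fin V)) {p : Fin V → Fin K → ℝ} (hp : ∀ j k, 0 ≤ p j k)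
    (hsum : ∀ j, ∑ k, p j k = 1) (k : Fin K) {a : Fin V → ℝ} (ha : ∀ j ∈ W, |a j| ≤ 1) :
    ∫⁻ z : Setup.Round V K, ENNReal.ofReal (∏ j ∈ W, Real.exp (a j * gain (p j) k (z j) -
      (a j * (p j k * mean ν k) + a j ^ 2 * p j k))) ∂(Measure.pi fun _ => agentLaw ν) ≤ 1 := by
  classical
  -- The factor 1 outside `W` extends the product to all agents, so that the integral over the
  -- product measure factorises.
  set f : Fin V → ℝ × (Fin K → ℝ) → ℝ := fun j y => if j ∈ W then
    Real.exp (a j * gain (p j) k y) * Real.exp (-(a j * (p j k * mean ν k) + a j ^ 2 * p j k))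
    else 1 with hf
  have hprod : ∀ z : Setup.Round V K, ∏ j ∈ W, Real.exp (a j * gain (p j) k (z j) -
      (a j * (p j k * mean ν k) + a j ^ 2 * p j k)) = ∏ j, f j (z j) := by
    intro z
    simp only [hf]
    rw [Finset.prod_ite_mem, Finset.univ_inter]
    exact Finset.prod_congr rfl fun j _ => by rw [← Real.exp_add, sub_eq_add_neg]
  have hint : ∀ j, Integrable (f j) (agentLaw ν) := by
    intro j
    by_cases hj : j ∈ W
    · simp only [hf, if_pos hj]
      exact (integrable_exp_gain h01 (p j) k (a j)).mul_const _
    · simp only [hf, if_neg hj]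
      exact integrable_const _
  have hf0 : ∀ j y, 0 ≤ f j y := by
    intro j y
    simp only [hf]
    split_ifs <;> positivity
  have hf1 : ∀ j, ∫ y, f j y ∂(agentLaw ν) ≤ 1 := by
    intro j
    by_cases hj : j ∈ W
    · simp only [hf, if_pos hj]
      rw [integral_mul_const]
      calc _ ≤ Real.exp (a j * (p j k * mean ν k) + a j ^ 2 * p j k) *
            Real.exp (-(a j * (p j k * mean ν k) + a j ^ 2 * p j k)) := by
              gcongr
              exact integral_exp_gain_le h01 (hp j) (hsum j) k (ha j hj)
        _ = 1 := by rw [← Real.exp_add]; simp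
    · simp only [hf, if_neg hj]
      simp
  simp_rw [hprod]
  rw [← ofReal_integral_eq_lintegral_ofReal (Integrable.fintype_prod hint)
    (Filter.Eventually.of_forall fun z => Finset.prod_nonneg fun j _ => hf0 j _),
    integral_fintype_prod_eq_prod]
  refine ENNReal.ofReal_le_one.mpr (Finset.prod_le_one (fun j _ => ?_) fun j _ => hf1 j)
  exact integral_nonneg fun y => hf0 j y

end Tilt

namespace Setup

variable {V K : ℕ} {P : Setup V K}

theorem Admissible.alloc_div_nonneg (hP : P.Admissible) (hT : 1 ≤ P.T) (m : ℕ) (i : Fin V)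
    (D : Fin K → ℝ) (k : Fin K) : 0 ≤ P.alloc m i D k / P.len m :=
  div_nonneg (hP.alloc_nonneg hT m i D k) (Nat.cast_nonneg _)

theorem Admissible.threshold_mul (hP : P.Admissible) (i : Fin V) {δ : ℝ} (hδ : 0 < δ) :
    (1 - 2 * P.α) * (nbhd P.G 1 i).card * (P.threshold i δ * δ ^ 2) = P.lam := by
  rw [threshold, div_mul_eq_mul_div, mul_div_cancel₀ _ (hP.nbhd_mul_pos i).ne', mul_assoc,
    inv_mul_cancel₀ (by positivity), mul_one]

variable [NeZero K]

theorem Admissible.sum_alloc_div (hP : P.Admissible) (hT : 1 ≤ P.T) (m : ℕ) (i : Fin V)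
    (D : Fin K → ℝ) : ∑ k, P.alloc m i D k / P.len m = 1 := by
  rw [← Finset.sum_div, P.sum_alloc]
  exact div_self (by exact_mod_cast (hP.len_pos hT m).ne')

theorem measurable_tilt (P : Setup V K) {α : Type*} [MeasurableSpace α]
    {D : α → Fin V → Fin K → ℝ} (hD : ∀ j k, Measurable fun q => D q j k) {θ : α → ℝ}
    (hθ : Measurable θ) (m : ℕ) (W : Finset (Fin V)) (k : Fin K) (c : ℝ) :
    Measurable fun q : α × Round V K => ENNReal.ofReal (∏ j ∈ W, Real.exp
      (θ q.1 / P.alloc m j (D q.1 j) k *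
          gain (fun l => P.alloc m j (D q.1 j) l / P.len m) k (q.2 j) -
        (θ q.1 / P.alloc m j (D q.1 j) k * (P.alloc m j (D q.1 j) k / P.len m * c) +
          (θ q.1 / P.alloc m j (D q.1 j) k) ^ 2 * (P.alloc m j (D q.1 j) k / P.len m)))) := by
  refine (Finset.measurable_prod _ fun j _ => ?_).ennreal_ofReal
  have hal : ∀ l, Measurable fun q : α × Round V K => P.alloc m j (D q.1 j) l := fun l =>
    (P.measurable_alloc m j (hD j) l).comp measurable_fst
  have hθ' : Measurable fun q : α × Round V K => θ q.1 / P.alloc m j (D q.1 j) k :=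
    (hθ.comp measurable_fst).div (hal k)
  have hz : Measurable fun q : α × Round V K => q.2 j :=
    (measurable_pi_apply j).comp measurable_snd
  have hdraw : Measurable fun q : α × Round V K =>
      draw (fun l => P.alloc m j (D q.1 j) l / P.len m) (q.2 j).1 :=
    measurable_draw (fun l => (hal l).div_const _) hz.fst
  have hset : MeasurableSet {q : α × Round V K |
      draw (fun l => P.alloc m j (D q.1 j) l / P.len m) (q.2 j).1 = k} :=
    hdraw (measurableSet_singleton k)
  have hg : Measurable fun q : α × Round V K =>
      gain (fun l => P.alloc m j (D q.1 j) l / P.len m) k (q.2 j) :=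
    Measurable.ite hset ((measurable_pi_apply k).comp hz.snd) measurable_const
  exact ((hθ'.mul hg).sub ((hθ'.mul (((hal k).div_const _).mul_const c)).add
    ((hθ'.pow_const 2).mul ((hal k).div_const _)))).exp

variable {ν : Fin K → Measure ℝ} {Ω : Type*} [mΩ : MeasurableSpace Ω] {Q : Measure Ω}

theorem Environment.sum_gain (E : P.Environment ν Q) (m : ℕ) (j : Fin V) (D : Fin K → ℝ)
    (k : Fin K) (ω : Ω) :
    ∑ t ∈ Finset.Ico (P.start m) (P.start m + P.len m),
      gain (fun l => P.alloc m j D l / P.len m) k (E.round t ω j) =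
      P.rewardSum m j D (E.path ω) k := rfl

/-- The product of the tilted rewards over an epoch. -/
theorem Environment.prod_tilt (E : P.Environment ν Q) (hP : P.Admissible) (hT : 1 ≤ P.T) (m : ℕ)
    (W : Finset (Fin V)) (k : Fin K) (c : ℝ) (D : Fin V → Fin K → ℝ) (θ : ℝ)
    (hD : ∀ j ∈ W, 0 < P.alloc m j (D j) k) (ω : Ω) :
    ∏ t ∈ Finset.Ico (P.start m) (P.start m + P.len m), ENNReal.ofReal (∏ j ∈ W, Real.exp
      (θ / P.alloc m j (D j) k *
          gain (fun l => P.alloc m j (D j) l / P.len m) k (E.round t ω j) -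
        (θ / P.alloc m j (D j) k * (P.alloc m j (D j) k / P.len m * c) +
          (θ / P.alloc m j (D j) k) ^ 2 * (P.alloc m j (D j) k / P.len m)))) =
    ENNReal.ofReal (Real.exp (∑ j ∈ W,
      (θ * (P.rewardSum m j (D j) (E.path ω) k / P.alloc m j (D j) k - c) -
        θ ^ 2 / P.alloc m j (D j) k))) := by
  rw [← ENNReal.ofReal_prod_of_nonneg fun t _ => Finset.prod_nonneg fun j _ => by positivity,
    Finset.prod_comm, Real.exp_sum]
  congr 1
  refine Finset.prod_congr rfl fun j hj => ?_
  rw [← Real.exp_sum, Finset.sum_sub_distrib, ← Finset.mul_sum, E.sum_gain, Finset.sum_const,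
    Nat.card_Ico, Nat.add_sub_cancel_left, nsmul_eq_mul]
  congr 1
  -- Over `len` rounds the draw probability `ñ / len` turns the compensators into `θ c` and `θ² /
  -- ñ`.
  have h1 := (hD j hj).ne'
  have h2 : (P.len m : ℝ) ≠ 0 := by exact_mod_cast (hP.len_pos hT m).ne'
  field_simp
  ring

/-- One-sided deviations of a pooled mean are unlikely. -/
theorem Environment.measure_deviation_le [IsProbabilityMeasure Q] (E : P.Environment ν Q)
    (hP : P.Admissible) (hT : 1 ≤ P.T) (hν : ∀ k, IsProbabilityMeasure (ν k))
    (h01 : ∀ k, ∀ᵐ y ∂(ν k), y ∈ Set.Icc (0 : ℝ) 1) (m : ℕ) (i : Fin V) (k : Fin K)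
    {W : Finset (Fin V)} (hW : (1 - 2 * P.α) * (nbhd P.G 1 i).card ≤ W.card) {s : ℝ}
    (hs : |s| = 1) :
    Q {ω | (∀ j ∈ W, P.threshold i (P.gap (E.path ω) m i k) ≤
          P.alloc m j (P.gap (E.path ω) m j) k) ∧ P.gap (E.path ω) m i k ≤ 4 ∧
        W.card * (P.gap (E.path ω) m i k / 8) < s * ∑ j ∈ W,
          (P.rewardSum m j (P.gap (E.path ω) m j) (E.path ω) k /
            P.alloc m j (P.gap (E.path ω) m j) k - mean ν k)} ≤
      ENNReal.ofReal (((2 * V * P.T) ^ 2)⁻¹) := by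
  set g : Ω → ℝ := fun ω => P.gap (E.path ω) m i k with hg
  set D : Ω → Fin V → Fin K → ℝ := fun ω => P.gap (E.path ω) m with hD
  -- With `n` the threshold, `|θ| = n g / 16` maximises `θ g / 8 - θ² / n`, with value `n g² / 256`.
  -- As `g ≤ 4`, the tilts `θ / ñ_j` do not exceed 1 in absolute value on `B`.
  set θ : Ω → ℝ := fun ω => s * (P.threshold i (g ω) * g ω / 16) with hθ
  have hDm : ∀ j k, Measurable[E.ℱ (P.start m)] fun ω => D ω j k := E.measurable_gap m
  have hthm : Measurable[E.ℱ (P.start m)] fun ω => P.threshold i (g ω) := by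
    have h1 : Measurable (P.threshold i) := by
      unfold threshold
      fun_prop
    exact h1.comp (hDm i k)
  have hθm : Measurable[E.ℱ (P.start m)] θ :=
    ((hthm.mul (hDm i k)).div_const 16).const_mul s
  set B : Set Ω := {ω | (∀ j ∈ W, P.threshold i (g ω) ≤ P.alloc m j (D ω j) k) ∧ g ω ≤ 4} with hB
  have hBm : MeasurableSet[E.ℱ (P.start m)] B := by
    have h1 : ∀ j, MeasurableSet[E.ℱ (P.start m)]
        {ω | P.threshold i (g ω) ≤ P.alloc m j (D ω j) k} := fun j =>
      @measurableSet_le _ _ _ _ _ (E.ℱ (P.start m)) _ _ _ _ _ hthm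
        (@Setup.measurable_alloc V K P Ω (E.ℱ (P.start m)) m j (fun ω => D ω j) (hDm j) k)
    have h2 : MeasurableSet[E.ℱ (P.start m)] {ω | g ω ≤ 4} :=
      @measurableSet_le _ _ _ _ _ (E.ℱ (P.start m)) _ _ _ _ _ (hDm i k) measurable_const
    have h3 : B = (⋂ j ∈ W, {ω | P.threshold i (g ω) ≤ P.alloc m j (D ω j) k}) ∩
        {ω | g ω ≤ 4} := by
      ext ω; simp [hB]
    rw [h3]
    exact MeasurableSet.inter (Finset.measurableSet_biInter _ fun j _ => h1 j) h2
  have hH := @measurable_tilt V K _ P Ω (E.ℱ (P.start m)) D hDm θ hθm m W k (mean ν k)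
  have hmain := lintegral_prod_rounds_le_one (Q := Q) E.ℱ (Z := E.round)
    (fun t => E.measurable_round t) (fun t => E.indep t) (fun t => E.law t) hBm hH ?_ (P.len m)
  swap
  · intro ω hω
    have hgpos : 0 < g ω := P.gap_pos _ m i k
    have hth := hP.threshold_pos hT i hgpos
    refine lintegral_tilt_le_one h01 W (p := fun j l => P.alloc m j (D ω j) l / P.len m)
      (fun j l => hP.alloc_div_nonneg hT m j _ l) (fun j => hP.sum_alloc_div hT m j _) k
      (a := fun j => θ ω / P.alloc m j (D ω j) k) fun j hj => ?_
    have h1 := hω.1 j hj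
    have h2 := hω.2
    have h3 : 0 < P.alloc m j (D ω j) k := hth.trans_le h1
    rw [abs_div, abs_of_pos h3, div_le_one h3]
    simp only [hθ]
    rw [abs_mul, hs, one_mul, abs_of_pos (by positivity)]
    nlinarith
  have hmeas := (measurable_prod_rounds E.ℱ (fun t => E.measurable_round t) hBm hH
    (P.len m)).mono (E.ℱ.le _) le_rfl
  have hVT := hP.one_le_mul hT
  have hpos : (0 : ℝ) < (2 * V * P.T) ^ 2 := by nlinarith
  refine le_trans (measure_mono ?_) ((meas_ge_le_lintegral_div (μ := Q) hmeas.aemeasurable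
    (ε := ENNReal.ofReal ((2 * V * P.T) ^ 2)) (ENNReal.ofReal_pos.mpr hpos).ne'
    ENNReal.ofReal_ne_top).trans ?_)
  · rintro ω ⟨h1, h2, h3⟩
    have hgpos : 0 < g ω := P.gap_pos _ m i k
    have hth := hP.threshold_pos hT i hgpos
    have hωB : ω ∈ B := ⟨h1, h2⟩
    have hal : ∀ j ∈ W, 0 < P.alloc m j (D ω j) k := fun j hj => hth.trans_le (h1 j hj)
    have hs2 : s ^ 2 = 1 := by rw [← sq_abs, hs, one_pow]
    change ENNReal.ofReal ((2 * V * P.T) ^ 2) ≤ _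
    rw [Set.indicator_of_mem hωB, Pi.one_apply, one_mul,
      E.prod_tilt hP hT m W k (mean ν k) (D ω) (θ ω) hal ω]
    refine ENNReal.ofReal_le_ofReal ?_
    have hlam := hP.threshold_mul i hgpos
    have hexp : P.lam / 256 ≤ ∑ j ∈ W,
        (θ ω * (P.rewardSum m j (D ω j) (E.path ω) k / P.alloc m j (D ω j) k - mean ν k) -
          θ ω ^ 2 / P.alloc m j (D ω j) k) := by
      rw [Finset.sum_sub_distrib, ← Finset.mul_sum]
      have h4 : ∑ j ∈ W, θ ω ^ 2 / P.alloc m j (D ω j) k ≤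
          W.card * (θ ω ^ 2 / P.threshold i (g ω)) := by
        rw [← nsmul_eq_mul]
        refine Finset.sum_le_card_nsmul _ _ _ fun j hj => ?_
        gcongr
        exact h1 j hj
      have h5 : θ ω ^ 2 / P.threshold i (g ω) = P.threshold i (g ω) * g ω ^ 2 / 256 := by
        simp only [hθ, mul_pow, hs2]
        field_simp
        norm_num
      have h6 : W.card * (P.threshold i (g ω) * g ω ^ 2 / 128) ≤ θ ω * ∑ j ∈ W,
          (P.rewardSum m j (D ω j) (E.path ω) k / P.alloc m j (D ω j) k - mean ν k) := by
        have h7 := mul_le_mul_of_nonneg_left h3.le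
          (show 0 ≤ P.threshold i (g ω) * g ω / 16 by positivity)
        simp only [hθ]
        calc _ = P.threshold i (g ω) * g ω / 16 * (W.card * (g ω / 8)) := by ring
          _ ≤ _ := h7
          _ = _ := by ring
      have h8 := mul_le_mul_of_nonneg_right hW
        (show 0 ≤ P.threshold i (g ω) * g ω ^ 2 by positivity)
      rw [h5] at h4
      linarith
    -- The factor `2⁹` in `λ` leaves exactly the exponent 2 here.
    have hlam' : P.lam / 256 = Real.log ((2 * V * P.T) ^ 2) := by
      rw [lam, Real.log_pow]; push_cast; ring
    rw [hlam'] at hexp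
    calc ((2 : ℝ) * V * P.T) ^ 2 = Real.exp (Real.log ((2 * V * P.T) ^ 2)) :=
          (Real.exp_log hpos).symm
      _ ≤ _ := Real.exp_le_exp.mpr hexp
  · rw [ENNReal.ofReal_inv_of_pos hpos, ← one_div]
    gcongr

/-- With high probability the pooled means are accurate in all epochs. -/
theorem Environment.measure_not_accurate_le [IsProbabilityMeasure Q] (E : P.Environment ν Q)
    (hP : P.Admissible) (hT : 1 ≤ P.T) (hν : ∀ k, IsProbabilityMeasure (ν k))
    (h01 : ∀ k, ∀ᵐ y ∂(ν k), y ∈ Set.Icc (0 : ℝ) 1) :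
    Q {ω | ∃ m < P.T, ¬ P.Accurate (mean ν) (E.path ω) m} ≤
      ENNReal.ofReal (K * 2 ^ V / P.T) := by
  classical
  set ev : ℕ → Fin V → Fin K → Finset (Fin V) → ℝ → Set Ω := fun m i k W s =>
    {ω | (∀ j ∈ W, P.threshold i (P.gap (E.path ω) m i k) ≤
          P.alloc m j (P.gap (E.path ω) m j) k) ∧ P.gap (E.path ω) m i k ≤ 4 ∧
        W.card * (P.gap (E.path ω) m i k / 8) < s * ∑ j ∈ W,
          (P.rewardSum m j (P.gap (E.path ω) m j) (E.path ω) k /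
            P.alloc m j (P.gap (E.path ω) m j) k - mean ν k)} with hev
  set q : ENNReal := ENNReal.ofReal (((2 * V * P.T) ^ 2)⁻¹) with hq
  have hbound : ∀ m i k (W : Finset (Fin V)) (s : ℝ), |s| = 1 →
      Q (if (1 - 2 * P.α) * (nbhd P.G 1 i).card ≤ W.card then ev m i k W s else ∅) ≤ q := by
    intro m i k W s hs
    split_ifs with hW
    · exact E.measure_deviation_le hP hT hν h01 m i k hW hs
    · simp
  have hsub : {ω | ∃ m < P.T, ¬ P.Accurate (mean ν) (E.path ω) m} ⊆
      ⋃ x ∈ (Finset.range P.T ×ˢ (Finset.univ : Finset (Fin V × Fin K × Finset (Fin V)))) ×ˢ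
        ({1, -1} : Finset ℝ),
        if (1 - 2 * P.α) * (nbhd P.G 1 x.1.2.1).card ≤ x.1.2.2.2.card then
          ev x.1.1 x.1.2.1 x.1.2.2.1 x.1.2.2.2 x.2 else ∅ := by
    rintro ω ⟨m, hm, hω⟩
    simp only [Accurate, not_forall, not_le] at hω
    obtain ⟨i, k, W, h1, h2, h3, h4⟩ := hω
    have hx : ∃ s ∈ ({1, -1} : Finset ℝ), ω ∈ ev m i k W s := by
      rcases lt_abs.mp h4 with h | h
      · exact ⟨1, by simp, fun j hj => (h1 j hj).2, h3, by rw [one_mul]; exact h⟩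
      · exact ⟨-1, by simp, fun j hj => (h1 j hj).2, h3, by rw [neg_one_mul]; exact h⟩
    obtain ⟨s, hs, hωs⟩ := hx
    simp only [Set.mem_iUnion]
    refine ⟨((m, i, k, W), s), ?_, ?_⟩
    · simp only [Finset.mem_product, Finset.mem_range, Finset.mem_univ, and_true]
      exact ⟨hm, hs⟩
    · simp only [if_pos h2]
      exact hωs
  refine (measure_mono hsub).trans ((measure_biUnion_finset_le _ _).trans ?_)
  refine (Finset.sum_le_card_nsmul _ _ q fun x hx => hbound _ _ _ _ _ ?_).trans ?_
  · have := (Finset.mem_product.mp hx).2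
    simp only [Finset.mem_insert, Finset.mem_singleton] at this
    rcases this with h | h <;> simp [h]
  · have hcard : ((Finset.range P.T ×ˢ
        (Finset.univ : Finset (Fin V × Fin K × Finset (Fin V)))) ×ˢ ({1, -1} : Finset ℝ)).card =
        P.T * (V * (K * 2 ^ V)) * 2 := by
      rw [Finset.card_product, Finset.card_product, Finset.card_range, Finset.card_univ,
        Fintype.card_prod, Fintype.card_prod, Fintype.card_finset, Fintype.card_fin,
        Fintype.card_fin, Finset.card_pair (by norm_num)]
    rw [hcard, hq, nsmul_eq_mul, ← ENNReal.ofReal_natCast,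
      ← ENNReal.ofReal_mul (Nat.cast_nonneg _)]
    refine ENNReal.ofReal_le_ofReal ?_
    have hV : (1 : ℝ) ≤ V := by exact_mod_cast hP.pos_card
    have hT' : (1 : ℝ) ≤ P.T := by exact_mod_cast hT
    push_cast
    rw [← div_eq_mul_inv, div_le_div_iff₀ (by positivity) (by positivity)]
    have h1 : (P.T : ℝ) * (V * (K * 2 ^ V)) * 2 * P.T = K * 2 ^ V * P.T ^ 2 * (2 * V) := by ring
    have h2 : (K : ℝ) * 2 ^ V * (2 * V * P.T) ^ 2 = K * 2 ^ V * P.T ^ 2 * (4 * V ^ 2) := by ring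
    rw [h1, h2]
    exact mul_le_mul_of_nonneg_left (by nlinarith) (by positivity)

end Setup

end DeMABAR

end

noncomputable section

namespace DeMABAR

/-! ### Gaps -/

section Gaps

variable {K : ℕ} (ν : Fin K → Measure ℝ)

theorem subGap_nonneg (k : Fin K) : 0 ≤ subGap ν k := by
  have := Setup.le_iSup_fin (mean ν) k
  rw [subGap, bestMean]
  linarith

theorem minGap_le {k : Fin K} (hk : 0 < subGap ν k) : minGap ν ≤ subGap ν k :=
  ciInf_le (Set.finite_range _).bddBelow (⟨k, hk⟩ : {k : Fin K // 0 < subGap ν k})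

theorem minGap_pos {k : Fin K} (hk : 0 < subGap ν k) : 0 < minGap ν := by
  have : Nonempty {k : Fin K // 0 < subGap ν k} := ⟨⟨k, hk⟩⟩
  obtain ⟨l, hl⟩ := exists_eq_ciInf_of_finite
    (f := fun k : {k : Fin K // 0 < subGap ν k} => subGap ν k.1)
  rw [minGap, ← hl]
  exact l.2

end Gaps

/-! ### The regret as a sum of conditional expectations -/

namespace Setup

variable {V K : ℕ} {P : Setup V K} {ν : Fin K → Measure ℝ} {Ω : Type*} [mΩ : MeasurableSpace Ω]
  {Q : Measure Ω}

theorem Environment.ae_round [IsProbabilityMeasure Q] (E : P.Environment ν Q)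
    (hν : ∀ k, IsProbabilityMeasure (ν k)) (h01 : ∀ k, ∀ᵐ y ∂(ν k), y ∈ Set.Icc (0 : ℝ) 1)
    (t : ℕ) (i : Fin V) : ∀ᵐ ω ∂Q, ∀ k, (E.path ω).x t i k ∈ Set.Icc (0 : ℝ) 1 := by
  have hm : Measurable (E.round t) := (E.measurable_round t).mono (E.ℱ.le _) le_rfl
  have h1 : ∀ᵐ z ∂(Measure.pi fun _ : Fin V => agentLaw ν), ∀ k, (z i).2 k ∈ Set.Icc (0 : ℝ) 1 :=
    (measurePreserving_eval (fun _ : Fin V => agentLaw ν) i).quasiMeasurePreserving.ae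
      (ae_agentLaw h01)
  have h2 : ∀ᵐ z ∂(Q.map (E.round t)), ∀ k, (z i).2 k ∈ Set.Icc (0 : ℝ) 1 := by
    rw [show Q.map (E.round t) = _ from E.law t]
    exact h1
  exact ae_of_ae_map hm.aemeasurable h2

variable [NeZero K]

/-- The expected regret of a normal agent `i` in round `t`, given the past. -/
def instRegret (P : Setup V K) (ν : Fin K → Measure ℝ) (ξ : Path V K) (i : Fin V) (t : ℕ) : ℝ :=
  open Classical in
  if P.IsComm t then subGap ν (P.lead (P.epoch t) i (P.gap ξ (P.epoch t) i))
  else ∑ k, P.alloc (P.epoch t) i (P.gap ξ (P.epoch t) i) k / P.len (P.epoch t) * subGap ν k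

theorem Admissible.instRegret_mem (hP : P.Admissible) (hT : 1 ≤ P.T)
    (hν : ∀ k, IsProbabilityMeasure (ν k)) (h01 : ∀ k, ∀ᵐ y ∂(ν k), y ∈ Set.Icc (0 : ℝ) 1)
    (ξ : Path V K) (i : Fin V) (t : ℕ) : P.instRegret ν ξ i t ∈ Set.Icc (0 : ℝ) 1 := by
  have h1 : ∀ k, subGap ν k ≤ 1 := fun k => iSup_sub_le_one (mean_mem h01) k
  unfold instRegret
  split_ifs
  · exact ⟨subGap_nonneg ν _, h1 _⟩
  · have hp := fun k => hP.alloc_div_nonneg hT (P.epoch t) i (P.gap ξ (P.epoch t) i) k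
    constructor
    · exact Finset.sum_nonneg fun k _ => mul_nonneg (hp k) (subGap_nonneg ν k)
    · calc _ ≤ ∑ k, P.alloc (P.epoch t) i (P.gap ξ (P.epoch t) i) k / P.len (P.epoch t) :=
          Finset.sum_le_sum fun k _ => mul_le_of_le_one_right (hp k) (h1 k)
        _ = 1 := hP.sum_alloc_div hT _ _ _

theorem Environment.measurable_gap_epoch (E : P.Environment ν Q) (t : ℕ) (i : Fin V) (k : Fin K) :
    Measurable[E.ℱ t] fun ω => P.gap (E.path ω) (P.epoch t) i k :=
  (E.measurable_gap (P.epoch t) i k).mono (E.ℱ.mono (P.start_epoch_le t)) le_rfl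

theorem Environment.measurable_instRegret (E : P.Environment ν Q) (i : Fin V) (t : ℕ) :
    Measurable fun ω => P.instRegret ν (E.path ω) i t := by
  have hD : ∀ k, Measurable fun ω => P.gap (E.path ω) (P.epoch t) i k := fun k =>
    (E.measurable_gap_epoch t i k).mono (E.ℱ.le _) le_rfl
  unfold instRegret
  split_ifs
  · exact (measurable_of_countable (subGap ν)).comp (P.measurable_lead _ i hD)
  · exact Finset.measurable_sum _ fun k _ =>
      ((P.measurable_alloc _ i hD k).div_const _).mul_const _

/-- The reward of an agent that has the gap estimates `D` in round `t`. -/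
def reward (P : Setup V K) (t : ℕ) (i : Fin V) (D : Fin K → ℝ) (y : ℝ × (Fin K → ℝ)) : ℝ :=
  open Classical in
  if P.IsComm t then ∑ k, if P.lead (P.epoch t) i D = k then y.2 k else 0
  else ∑ k, gain (fun l => P.alloc (P.epoch t) i D l / P.len (P.epoch t)) k y

/-- This separates the past, which enters through the gap estimates alone, from the agent's seed and
rewards of round `t`, as freezing requires. -/
theorem reward_arm (P : Setup V K) {i : Fin V} (hi : i ∉ P.byz) (ξ : Path V K) (t : ℕ) :
    ξ.x t i (P.arm ξ t i) =
      P.reward t i (P.gap ξ (P.epoch t) i) (ξ.u t i, ξ.x t i) := by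
  unfold arm reward gain explore
  rw [if_neg hi]
  split_ifs <;> simp

theorem reward_mem (P : Setup V K) (t : ℕ) (i : Fin V) (D : Fin K → ℝ) {y : ℝ × (Fin K → ℝ)}
    (hy : ∀ k, y.2 k ∈ Set.Icc (0 : ℝ) 1) : P.reward t i D y ∈ Set.Icc (0 : ℝ) 1 := by
  unfold reward gain
  split_ifs
  · rw [Finset.sum_ite_eq]
    simpa using hy _
  · rw [Finset.sum_ite_eq]
    simpa using hy _

theorem measurable_reward (P : Setup V K) {α : Type*} [MeasurableSpace α] {D : α → Fin K → ℝ}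
    (hD : ∀ k, Measurable fun q => D q k) {y : α → ℝ × (Fin K → ℝ)} (hy : Measurable y) (t : ℕ)
    (i : Fin V) : Measurable fun q => P.reward t i (D q) (y q) := by
  unfold reward gain
  split_ifs
  · refine Finset.measurable_sum _ fun k _ => ?_
    have hset : MeasurableSet {q | P.lead (P.epoch t) i (D q) = k} :=
      P.measurable_lead (P.epoch t) i hD (measurableSet_singleton k)
    exact Measurable.ite hset ((measurable_pi_apply k).comp hy.snd) measurable_const
  · refine Finset.measurable_sum _ fun k _ => ?_
    have hset : MeasurableSet {q |
        draw (fun l => P.alloc (P.epoch t) i (D q) l / P.len (P.epoch t)) (y q).1 = k} :=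
      P.measurable_explore (P.epoch t) i hD hy.fst (measurableSet_singleton k)
    exact Measurable.ite hset ((measurable_pi_apply k).comp hy.snd) measurable_const

theorem Admissible.integral_reward (hP : P.Admissible) (hT : 1 ≤ P.T)
    (hν : ∀ k, IsProbabilityMeasure (ν k)) (h01 : ∀ k, ∀ᵐ y ∂(ν k), y ∈ Set.Icc (0 : ℝ) 1)
    (ξ : Path V K) (i : Fin V) (t : ℕ) :
    ∫ y, P.reward t i (P.gap ξ (P.epoch t) i) y ∂(agentLaw ν) =
      bestMean ν - P.instRegret ν ξ i t := by
  unfold reward instRegret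
  split_ifs
  · simp only [Finset.sum_ite_eq, Finset.mem_univ, if_true]
    set k := P.lead (P.epoch t) i (P.gap ξ (P.epoch t) i)
    have h1 := integral_prod_mul (μ := volume.restrict (Set.Icc (0 : ℝ) 1)) (ν := Measure.pi ν)
      (fun _ => (1 : ℝ)) fun x : Fin K → ℝ => x k
    simp only [one_mul] at h1
    rw [h1, integral_eval]
    simp [subGap, mean]
  · rw [integral_finsetSum _ fun k _ => integrable_gain h01 _ k]
    have hp := fun k => hP.alloc_div_nonneg hT (P.epoch t) i (P.gap ξ (P.epoch t) i) k
    have hs := hP.sum_alloc_div hT (P.epoch t) i (P.gap ξ (P.epoch t) i)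
    simp_rw [integral_gain hp hs, subGap, mul_sub]
    rw [Finset.sum_sub_distrib, ← Finset.sum_mul, hs]
    ring

theorem Environment.integrable_instRegret [IsProbabilityMeasure Q] (E : P.Environment ν Q)
    (hP : P.Admissible) (hT : 1 ≤ P.T) (hν : ∀ k, IsProbabilityMeasure (ν k))
    (h01 : ∀ k, ∀ᵐ y ∂(ν k), y ∈ Set.Icc (0 : ℝ) 1) (i : Fin V) (t : ℕ) :
    Integrable (fun ω => P.instRegret ν (E.path ω) i t) Q := by
  refine Integrable.of_bound (E.measurable_instRegret i t).aestronglyMeasurable 1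
    (Filter.Eventually.of_forall fun ω => ?_)
  have := hP.instRegret_mem hT hν h01 (E.path ω) i t
  rw [Real.norm_eq_abs, abs_of_nonneg this.1]
  exact this.2

theorem Environment.integrable_reward [IsProbabilityMeasure Q] (E : P.Environment ν Q)
    (hν : ∀ k, IsProbabilityMeasure (ν k)) (h01 : ∀ k, ∀ᵐ y ∂(ν k), y ∈ Set.Icc (0 : ℝ) 1)
    (i : Fin V) (t : ℕ) : Integrable
      (fun ω => P.reward t i (P.gap (E.path ω) (P.epoch t) i) (E.round t ω i)) Q := by
  have hmeas := P.measurable_reward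
    (fun k => (E.measurable_gap_epoch t i k).mono (E.ℱ.le _) le_rfl)
    ((measurable_pi_apply i).comp ((E.measurable_round t).mono (E.ℱ.le _) le_rfl)) t i
  refine Integrable.of_bound hmeas.aestronglyMeasurable 1 ?_
  filter_upwards [E.ae_round hν h01 t i] with ω hω
  have := P.reward_mem t i (P.gap (E.path ω) (P.epoch t) i) (y := E.round t ω i) hω
  rw [Real.norm_eq_abs, abs_of_nonneg this.1]
  exact this.2

theorem Environment.integral_reward [IsProbabilityMeasure Q] (E : P.Environment ν Q)
    (hP : P.Admissible) (hT : 1 ≤ P.T) (hν : ∀ k, IsProbabilityMeasure (ν k))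
    (h01 : ∀ k, ∀ᵐ y ∂(ν k), y ∈ Set.Icc (0 : ℝ) 1) (i : Fin V) (t : ℕ) :
    ∫ ω, P.reward t i (P.gap (E.path ω) (P.epoch t) i) (E.round t ω i) ∂Q =
      bestMean ν - ∫ ω, P.instRegret ν (E.path ω) i t ∂Q := by
  have hD := E.measurable_gap_epoch t i
  set F : Ω × Round V K → ℝ := fun q =>
    P.reward t i (P.gap (E.path q.1) (P.epoch t) i) (q.2 i) with hFdef
  have hF : @Measurable (Ω × Round V K) ℝ ((E.ℱ t).prod inferInstance) _ F :=
    @measurable_reward V K _ P (Ω × Round V K) ((E.ℱ t).prod inferInstance)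
      (fun q => P.gap (E.path q.1) (P.epoch t) i)
      (fun k => (hD k).comp (@measurable_fst Ω (Round V K) (E.ℱ t) _)) (fun q => q.2 i)
      ((measurable_pi_apply i).comp (@measurable_snd Ω (Round V K) (E.ℱ t) _)) t i
  -- The estimates of the current epoch are known before round `t`, which is independent of the
  -- past.
  have h1 := @integral_indepFun Ω Ω (Round V K) mΩ (E.ℱ t) inferInstance Q _ id (E.round t)
    (measurable_id'' (E.ℱ.le t)) ((E.measurable_round t).mono (E.ℱ.le _) le_rfl)
    (indepFun_id_of_indep (E.indep t)) F hF (E.integrable_reward hν h01 i t)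
  refine h1.trans ?_
  have h2 : ∀ ω, ∫ z, F (id ω, z) ∂(Q.map (E.round t)) =
      bestMean ν - P.instRegret ν (E.path ω) i t := by
    intro ω
    rw [show Q.map (E.round t) = _ from E.law t, ← hP.integral_reward hT hν h01]
    exact integral_comp_eval (μ := fun _ : Fin V => agentLaw ν) (i := i)
      (f := P.reward t i (P.gap (E.path ω) (P.epoch t) i))
      (P.measurable_reward (D := fun _ => P.gap (E.path ω) (P.epoch t) i)
        (fun _ => measurable_const) measurable_id t i).aestronglyMeasurable
  simp_rw [h2]
  rw [integral_sub (integrable_const _) (E.integrable_instRegret hP hT hν h01 i t)]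
  simp

/-- The regret is the expected sum of the conditional regrets of the rounds. -/
theorem Environment.regret_eq [IsProbabilityMeasure Q] (E : P.Environment ν Q)
    (hP : P.Admissible) (hT : 1 ≤ P.T) (hν : ∀ k, IsProbabilityMeasure (ν k))
    (h01 : ∀ k, ∀ᵐ y ∂(ν k), y ∈ Set.Icc (0 : ℝ) 1) {i : Fin V} (hi : i ∉ P.byz) :
    regret P ν E i = ∫ ω, ∑ t ∈ Finset.range P.T, P.instRegret ν (E.path ω) i t ∂Q := by
  have hx : ∀ t ω, (E.path ω).x t i (P.arm (E.path ω) t i) =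
      P.reward t i (P.gap (E.path ω) (P.epoch t) i) (E.round t ω i) := fun t ω =>
    P.reward_arm hi (E.path ω) t
  unfold regret
  simp_rw [hx]
  rw [integral_finsetSum _ fun t _ => E.integrable_reward hν h01 i t,
    integral_finsetSum _ fun t _ => E.integrable_instRegret hP hT hν h01 i t]
  simp_rw [E.integral_reward hP hT hν h01]
  rw [Finset.sum_sub_distrib]
  simp

end Setup

end DeMABAR

end

namespace DeMABAR

namespace Setup

/-! ### The regret bound -/

/-- The sum is geometric and its last nonzero term is at most `3 / Δ`. The auxiliary bound `2 ^ M`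
says that a new term at most doubles the sum's upper bound. -/
theorem sum_two_pow_le {Δ : ℝ} (hΔ : 0 < Δ) (M : ℕ) :
    ∑ m ∈ Finset.range M, (if 2 ^ m * Δ ≤ 3 then (2 : ℝ) ^ m else 0) ≤ 6 / Δ := by
  suffices h : ∑ m ∈ Finset.range M, (if 2 ^ m * Δ ≤ 3 then (2 : ℝ) ^ m else 0) ≤ 6 / Δ ∧
      ∑ m ∈ Finset.range M, (if 2 ^ m * Δ ≤ 3 then (2 : ℝ) ^ m else 0) ≤ 2 ^ M from h.1
  induction M with
  | zero => simp; positivity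
  | succ M ih =>
    rw [Finset.sum_range_succ]
    split_ifs with h
    · constructor
      · rw [le_div_iff₀ hΔ]
        nlinarith [ih.2]
      · rw [pow_succ]
        linarith [ih.2]
    · rw [add_zero]
      refine ⟨ih.1, ih.2.trans ?_⟩
      exact pow_le_pow_right₀ (by norm_num) (by omega)

variable {V K : ℕ} {P : Setup V K}

theorem Admissible.len_le (hP : P.Admissible) (hT : 1 ≤ P.T) (m : ℕ) :
    (P.len m : ℝ) ≤ P.lam * K / ((1 - 2 * P.α) * vMin P.G 1) * 2 ^ (2 * m) + 1 := by
  have h1 := hP.lam_pos hT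
  have h2 := hP.vMin_mul_pos
  have h3 : P.lam * K / ((1 - 2 * P.α) * vMin P.G 1) * 2 ^ (2 * m) =
      P.lam * K * 2 ^ (2 * m) / ((1 - 2 * P.α) * vMin P.G 1) := by ring
  rw [h3]
  exact (Nat.ceil_lt_add_one (by positivity)).le

variable [NeZero K] {ν : Fin K → Measure ℝ}

/-- The regret of one epoch with correct gap estimates. -/
theorem Admissible.epoch_regret_le (hP : P.Admissible) (hT : 1 ≤ P.T) (hV : (V : ℝ) ≤ P.lam)
    {ξ : Path V K} {m : ℕ} (hgap : P.GapBounds (mean ν) ξ m) {i : Fin V} (hi : i ∉ P.byz) :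
    ∑ k, P.alloc m i (P.gap ξ m i) k * subGap ν k + subGap ν (P.lead m i (P.gap ξ m i)) ≤
      67 * P.lam / ((1 - 2 * P.α) * vLoc P.G 1 i) * ∑ k with 0 < subGap ν k, (subGap ν k)⁻¹ +
      7 * (P.lam * K / ((1 - 2 * P.α) * vMin P.G 1)) *
        (if 2 ^ m * minGap ν ≤ 3 then (2 : ℝ) ^ m else 0) := by
  classical
  have hlam := hP.lam_pos hT
  have hvl := hP.vLoc_mul_pos i
  have hvm := hP.vMin_mul_pos
  have hK : (1 : ℝ) ≤ K := by exact_mod_cast NeZero.one_le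
  have hlow : ∀ k, 24 / 49 * subGap ν k ≤ P.gap ξ m i k := fun k => (hgap i hi k).2
  set a := P.lead m i (P.gap ξ m i) with ha
  set A := 67 * P.lam / ((1 - 2 * P.α) * vLoc P.G 1 i) with hA
  set R := P.lam * K / ((1 - 2 * P.α) * vMin P.G 1) with hR
  have hA0 : 0 < A := by positivity
  -- This lets `R` absorb the rounding of the epoch length and the communication round.
  have hR1 : 1 ≤ R := by
    rw [hR, le_div_iff₀ hvm, one_mul]
    have h1 : (vMin P.G 1 : ℝ) ≤ V := by exact_mod_cast vMin_le P.G 1 i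
    have h2 := hP.one_sub_le
    calc (1 - 2 * P.α) * vMin P.G 1 ≤ 1 * V := by gcongr
      _ ≤ P.lam * 1 := by linarith
      _ ≤ P.lam * K := by gcongr
  have hnon : ∑ k ∈ Finset.univ.erase a, P.alloc m i (P.gap ξ m i) k * subGap ν k ≤
      A * ∑ k with 0 < subGap ν k, (subGap ν k)⁻¹ := by
    rw [Finset.mul_sum, Finset.sum_filter]
    have hterm : ∀ k ∈ Finset.univ.erase a, P.alloc m i (P.gap ξ m i) k * subGap ν k ≤
        if 0 < subGap ν k then A * (subGap ν k)⁻¹ else 0 := by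
      intro k hk
      rw [P.alloc_of_ne (Finset.ne_of_mem_erase hk)]
      split_ifs with hpos
      · have h1 : P.baseAlloc m i (P.gap ξ m i k) ≤
            16 * P.lam * (P.gap ξ m i k ^ 2)⁻¹ / ((1 - 2 * P.α) * vLoc P.G 1 i) :=
          min_le_left _ _
        have h2 : (P.gap ξ m i k ^ 2)⁻¹ ≤ ((24 / 49 * subGap ν k) ^ 2)⁻¹ := by
          gcongr
          exact hlow k
        calc P.baseAlloc m i (P.gap ξ m i k) * subGap ν k
            ≤ 16 * P.lam * ((24 / 49 * subGap ν k) ^ 2)⁻¹ / ((1 - 2 * P.α) * vLoc P.G 1 i) *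
              subGap ν k := by
              refine mul_le_mul_of_nonneg_right (h1.trans ?_) hpos.le
              gcongr
          _ = 16 * (49 / 24) ^ 2 * P.lam / ((1 - 2 * P.α) * vLoc P.G 1 i) * (subGap ν k)⁻¹ := by
              have := hpos.ne'
              rw [mul_pow, mul_inv]
              have h3 : ((subGap ν k) ^ 2)⁻¹ * subGap ν k = (subGap ν k)⁻¹ := by
                field_simp
              rw [← h3]
              ring
          -- The constant is `16 · (49/24)² < 67`.
          _ ≤ A * (subGap ν k)⁻¹ := by
              rw [hA]
              gcongr
              norm_num
      · rw [le_antisymm (not_lt.mp hpos) (subGap_nonneg ν k), mul_zero]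
    refine (Finset.sum_le_sum hterm).trans
      (Finset.sum_le_sum_of_subset_of_nonneg (Finset.subset_univ _) fun k _ _ => ?_)
    split_ifs <;> positivity
  have hlead : P.alloc m i (P.gap ξ m i) a * subGap ν a + subGap ν a ≤
      7 * R * (if 2 ^ m * minGap ν ≤ 3 then (2 : ℝ) ^ m else 0) := by
    have hal : P.alloc m i (P.gap ξ m i) a ≤ P.len m := by
      rw [← P.sum_alloc m i (P.gap ξ m i)]
      exact Finset.single_le_sum (fun k _ => hP.alloc_nonneg hT m i _ k) (Finset.mem_univ a)
    rcases (subGap_nonneg ν a).eq_or_lt with h0 | hpos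
    · rw [← h0]
      have : (0 : ℝ) ≤ if 2 ^ m * minGap ν ≤ 3 then (2 : ℝ) ^ m else 0 := by
        split_ifs <;> positivity
      simp only [mul_zero, add_zero]
      positivity
    · have h1 : 24 / 49 * subGap ν a ≤ (1 / 2) ^ m := by
        rw [← hP.gap_lead ξ m i]
        exact hlow a
      have h2 : (2 : ℝ) ^ m * (1 / 2) ^ m = 1 := by
        rw [← mul_pow]; norm_num
      have h3 : (0 : ℝ) < 2 ^ m := by positivity
      -- The leading arm has estimate `2⁻ᵐ`, so if suboptimal its gap is at most `49/24 · 2⁻ᵐ`;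
      -- later epochs can have only optimal leaders.
      have h4 : 2 ^ m * subGap ν a ≤ 49 / 24 := by nlinarith
      have h5 : 2 ^ m * minGap ν ≤ 2 ^ m * subGap ν a := by
        gcongr
        exact minGap_le ν hpos
      rw [if_pos (by linarith)]
      have h6 : (1 : ℝ) ≤ 2 ^ (2 * m) := one_le_pow₀ (by norm_num)
      have h7 : (P.len m : ℝ) + 1 ≤ 3 * R * 2 ^ (2 * m) := by
        have := hP.len_le hT m
        rw [← hR] at this
        nlinarith
      have h8 : (2 : ℝ) ^ (2 * m) = 2 ^ m * 2 ^ m := by rw [two_mul, pow_add]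
      calc P.alloc m i (P.gap ξ m i) a * subGap ν a + subGap ν a
          = (P.alloc m i (P.gap ξ m i) a + 1) * subGap ν a := by ring
        _ ≤ (3 * R * 2 ^ (2 * m)) * subGap ν a := by
            refine mul_le_mul_of_nonneg_right ?_ hpos.le
            linarith
        _ = 3 * R * 2 ^ m * (2 ^ m * subGap ν a) := by rw [h8]; ring
        _ ≤ 3 * R * 2 ^ m * (49 / 24) := by gcongr
        _ ≤ 7 * R * 2 ^ m := by nlinarith [mul_pos (lt_of_lt_of_le one_pos hR1) h3]
  rw [← Finset.add_sum_erase _ _ (Finset.mem_univ a)]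
  linarith

/-- The regret of a run in which all pooled means are accurate. -/
theorem Admissible.sum_instRegret_le (hP : P.Admissible) (hT : 1 ≤ P.T) (hV : (V : ℝ) ≤ P.lam)
    (hν : ∀ k, IsProbabilityMeasure (ν k)) (h01 : ∀ k, ∀ᵐ y ∂(ν k), y ∈ Set.Icc (0 : ℝ) 1)
    {ξ : Path V K} (hacc : ∀ m < P.T, P.Accurate (mean ν) ξ m) {i : Fin V} (hi : i ∉ P.byz)
    (hΔ : 0 < minGap ν) :
    ∑ t ∈ Finset.range P.T, P.instRegret ν ξ i t ≤
      (Nat.log 2 (V * P.T) + 1) * (67 * P.lam / ((1 - 2 * P.α) * vLoc P.G 1 i) *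
        ∑ k with 0 < subGap ν k, (subGap ν k)⁻¹) +
      42 * (P.lam * K / ((1 - 2 * P.α) * vMin P.G 1)) / minGap ν := by
  set M := Nat.log 2 (V * P.T) + 1 with hM
  set A := 67 * P.lam / ((1 - 2 * P.α) * vLoc P.G 1 i) * ∑ k with 0 < subGap ν k, (subGap ν k)⁻¹
    with hA
  set R := P.lam * K / ((1 - 2 * P.α) * vMin P.G 1) with hR
  -- Extending the regret by zero after the horizon allows summation over whole epochs.
  set φ : ℕ → ℝ := fun t => if t < P.T then P.instRegret ν ξ i t else 0 with hφ
  have hmem := hP.instRegret_mem hT hν h01 ξ i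
  have hφ0 : ∀ t, 0 ≤ φ t := fun t => by
    simp only [hφ]
    split_ifs
    · exact (hmem t).1
    · exact le_rfl
  have hφle : ∀ t, φ t ≤ P.instRegret ν ξ i t := fun t => by
    simp only [hφ]
    split_ifs
    · exact le_rfl
    · exact (hmem t).1
  have hlam := hP.lam_pos hT
  have hvl := hP.vLoc_mul_pos i
  have hvm := hP.vMin_mul_pos
  have hA0 : 0 ≤ A := mul_nonneg (by positivity)
    (Finset.sum_nonneg fun k _ => inv_nonneg.mpr (subGap_nonneg ν k))
  have hR0 : 0 ≤ R := by positivity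
  have hepoch : ∀ m, ∑ t ∈ Finset.Ico (P.start m) (P.start m + P.len m), φ t +
      φ (P.start m + P.len m) ≤
      A + 7 * R * (if 2 ^ m * minGap ν ≤ 3 then (2 : ℝ) ^ m else 0) := by
    intro m
    by_cases hm : P.start m < P.T
    · have hmT : m < P.T := P.start_strictMono.le_apply.trans_lt hm
      have hgap : P.GapBounds (mean ν) ξ m :=
        hP.gapBounds hT (mean_mem h01) fun m' hm' => hacc m' (hm'.trans hmT)
      refine le_trans ?_ (hP.epoch_regret_le hT hV hgap hi)
      refine add_le_add ?_ ?_
      · have hlen : (P.len m : ℝ) ≠ 0 := by exact_mod_cast (hP.len_pos hT m).ne'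
        have h1 : ∀ t ∈ Finset.Ico (P.start m) (P.start m + P.len m), φ t ≤
            ∑ k, P.alloc m i (P.gap ξ m i) k / P.len m * subGap ν k := by
          intro t ht
          refine (hφle t).trans (le_of_eq ?_)
          rw [instRegret, (P.epoch_explore ht).1, if_neg (P.epoch_explore ht).2]
        refine (Finset.sum_le_card_nsmul _ _ _ h1).trans (le_of_eq ?_)
        rw [Nat.card_Ico, Nat.add_sub_cancel_left, nsmul_eq_mul, Finset.mul_sum]
        refine Finset.sum_congr rfl fun k _ => ?_
        field_simp
      · refine (hφle _).trans (le_of_eq ?_)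
        rw [instRegret, (P.epoch_comm m).1, if_pos (P.epoch_comm m).2]
    · have hz : ∀ t, P.start m ≤ t → φ t = 0 := fun t ht => if_neg (by omega)
      rw [Finset.sum_eq_zero fun t ht => hz t (Finset.mem_Ico.mp ht).1, hz _ (by omega), add_zero]
      split_ifs <;> positivity
  calc ∑ t ∈ Finset.range P.T, P.instRegret ν ξ i t = ∑ t ∈ Finset.range P.T, φ t :=
        Finset.sum_congr rfl fun t ht => (if_pos (Finset.mem_range.mp ht)).symm
    _ ≤ ∑ t ∈ Finset.range (P.start M), φ t :=
        Finset.sum_le_sum_of_subset_of_nonneg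
          (Finset.range_subset_range.mpr (hP.le_start hT)) fun t _ _ => hφ0 t
    _ ≤ ∑ m ∈ Finset.range M, (A + 7 * R * (if 2 ^ m * minGap ν ≤ 3 then (2 : ℝ) ^ m else 0)) := by
        rw [P.sum_range_start]
        exact Finset.sum_le_sum fun m _ => hepoch m
    _ = M * A + 7 * R *
          ∑ m ∈ Finset.range M, (if 2 ^ m * minGap ν ≤ 3 then (2 : ℝ) ^ m else 0) := by
        rw [Finset.sum_add_distrib, Finset.sum_const, Finset.card_range, nsmul_eq_mul,
          Finset.mul_sum _ _ (7 * R)]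
    _ ≤ M * A + 7 * R * (6 / minGap ν) := by
        gcongr
        exact sum_two_pow_le hΔ M
    _ = _ := by rw [hM]; push_cast; ring

variable {Ω : Type*} [mΩ : MeasurableSpace Ω] {Q : Measure Ω}

/-- A bound on accurate runs gives a bound on the regret. -/
theorem Environment.regret_le [IsProbabilityMeasure Q] (E : P.Environment ν Q)
    (hP : P.Admissible) (hT : 1 ≤ P.T) (hν : ∀ k, IsProbabilityMeasure (ν k))
    (h01 : ∀ k, ∀ᵐ y ∂(ν k), y ∈ Set.Icc (0 : ℝ) 1) {i : Fin V} (hi : i ∉ P.byz) {b : ℝ}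
    (hb0 : 0 ≤ b) (hb : ∀ ω, (∀ m < P.T, P.Accurate (mean ν) (E.path ω) m) →
      ∑ t ∈ Finset.range P.T, P.instRegret ν (E.path ω) i t ≤ b) :
    regret P ν E i ≤ b + K * 2 ^ V := by
  have hT' : (0 : ℝ) < P.T := by exact_mod_cast hT
  -- A measurable hull has the same measure as the failure event and an indicator that can be
  -- integrated. On it the regret is at most `T`.
  set U := toMeasurable Q {ω | ∃ m < P.T, ¬ P.Accurate (mean ν) (E.path ω) m} with hU
  have hUm : MeasurableSet U := measurableSet_toMeasurable _ _
  have hQU : Q.real U ≤ K * 2 ^ V / P.T := by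
    rw [measureReal_def, hU, measure_toMeasurable]
    exact ENNReal.toReal_le_of_le_ofReal (by positivity)
      (E.measure_not_accurate_le hP hT hν h01)
  rw [E.regret_eq hP hT hν h01 hi]
  calc ∫ ω, ∑ t ∈ Finset.range P.T, P.instRegret ν (E.path ω) i t ∂Q
      ≤ ∫ ω, (b + U.indicator (fun _ => (P.T : ℝ)) ω) ∂Q := by
        refine integral_mono
          (integrable_finsetSum _ fun t _ => E.integrable_instRegret hP hT hν h01 i t)
          ((integrable_const _).add ((integrable_const _).indicator hUm)) fun ω => ?_
        by_cases hω : ω ∈ U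
        · have h1 : ∑ t ∈ Finset.range P.T, P.instRegret ν (E.path ω) i t ≤ P.T := by
            have := Finset.sum_le_card_nsmul (Finset.range P.T)
              (fun t => P.instRegret ν (E.path ω) i t) 1
              fun t _ => (hP.instRegret_mem hT hν h01 (E.path ω) i t).2
            simpa using this
          simp only [Set.indicator_of_mem hω]
          linarith
        · simp only [Set.indicator_of_notMem hω, add_zero]
          refine hb ω fun m hm => ?_
          by_contra hc
          exact hω (subset_toMeasurable _ _ ⟨m, hm, hc⟩)
    _ = b + Q.real U * P.T := by
        rw [integral_add (integrable_const _) ((integrable_const _).indicator hUm),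
          integral_indicator_const _ hUm]
        simp
    _ ≤ b + K * 2 ^ V / P.T * P.T := by gcongr
    _ = b + K * 2 ^ V := by rw [div_mul_cancel₀ _ hT'.ne']

/-- The regret bound for long horizons. -/
theorem Environment.regret_le_of_large [IsProbabilityMeasure Q] (E : P.Environment ν Q)
    (hP : P.Admissible) (hT : 1 ≤ P.T) (hlarge : (K : ℝ) * 2 ^ V ≤ Real.log (V * P.T))
    (hν : ∀ k, IsProbabilityMeasure (ν k)) (h01 : ∀ k, ∀ᵐ y ∂(ν k), y ∈ Set.Icc (0 : ℝ) 1)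
    {i : Fin V} (hi : i ∉ P.byz) :
    regret P ν E i ≤ 300000 * (Real.log (V * P.T) / (1 - 2 * P.α) *
      ((∑ k with 0 < subGap ν k, Real.log (V * P.T) / (vLoc P.G 1 i * subGap ν k)) +
        K * Real.log (1 / minGap ν) / (vMin P.G 1 * minGap ν))) := by
  by_cases hex : ∃ k, 0 < subGap ν k
  swap
  · have hz : ∀ k, subGap ν k = 0 := fun k =>
      le_antisymm (not_lt.mp fun h => hex ⟨k, h⟩) (subGap_nonneg ν k)
    have hemp : IsEmpty {k : Fin K // 0 < subGap ν k} := ⟨fun k => hex ⟨k.1, k.2⟩⟩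
    -- The infimum over the empty family is 0, and division by 0 gives 0, so the right-hand side
    -- vanishes.
    have hmin : minGap ν = 0 := Real.iInf_of_isEmpty _
    rw [E.regret_eq hP hT hν h01 hi]
    have hinst : ∀ ω t, P.instRegret ν (E.path ω) i t = 0 := fun ω t => by
      unfold instRegret
      simp [hz]
    simp [hinst, hz, hmin]
  obtain ⟨k₀, hk₀⟩ := hex
  set ℓ := Real.log (V * P.T) with hℓ
  set Δ := minGap ν with hΔdef
  have hΔ : 0 < Δ := minGap_pos ν hk₀
  have hΔ1 : ∀ k, subGap ν k ≤ 1 := fun k => iSup_sub_le_one (mean_mem h01) k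
  have hΔle : Δ ≤ 1 := (minGap_le ν hk₀).trans (hΔ1 k₀)
  have hα := hP.one_sub_pos
  have hα' := hP.one_sub_le
  have hV1 : (1 : ℝ) ≤ V := by exact_mod_cast hP.pos_card
  have hK1 : (1 : ℝ) ≤ K := by exact_mod_cast NeZero.one_le
  have hV2 : (V : ℝ) ≤ 2 ^ V := by exact_mod_cast Nat.lt_two_pow_self.le
  have hKV : (K : ℝ) * V ≤ ℓ := le_trans (by gcongr) hlarge
  have hVℓ : (V : ℝ) ≤ ℓ := (le_mul_of_one_le_left (by linarith) hK1).trans hKV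
  have hℓ1 : 1 ≤ ℓ := hV1.trans hVℓ
  have hVT := hP.one_le_mul hT
  have hlam : P.lam = 512 * (Real.log 2 + ℓ) := by
    rw [lam, mul_assoc, Real.log_mul (by norm_num) (by linarith), ← hℓ]
    norm_num
  have hlog2 := Real.log_two_lt_d9
  have hlog2' := Real.log_two_gt_d9
  have hlamle : P.lam ≤ 1024 * ℓ := by rw [hlam]; linarith
  have hVlam : (V : ℝ) ≤ P.lam := by rw [hlam]; linarith
  have hvl : (0 : ℝ) < vLoc P.G 1 i := by exact_mod_cast vLoc_pos P.G 1 i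
  have hvlV : (vLoc P.G 1 i : ℝ) ≤ V := by exact_mod_cast vLoc_le P.G 1 i
  have hvm : (0 : ℝ) < vMin P.G 1 := by exact_mod_cast vMin_pos P.G 1 i
  have hvm1 : (1 : ℝ) ≤ vMin P.G 1 := by exact_mod_cast vMin_pos P.G 1 i
  have hMle : (Nat.log 2 (V * P.T) : ℝ) + 1 ≤ 3 * ℓ := by
    have := hP.natLog_le hT
    linarith
  have hlampos := hP.lam_pos hT
  set S := ∑ k with 0 < subGap ν k, (subGap ν k)⁻¹ with hS
  have hS1 : 1 ≤ S := by
    have h1 : (subGap ν k₀)⁻¹ ≤ S := Finset.single_le_sum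
      (f := fun k => (subGap ν k)⁻¹) (fun k _ => inv_nonneg.mpr (subGap_nonneg ν k)) (by simp [hk₀])
    exact (one_le_inv₀ hk₀ |>.mpr (hΔ1 k₀)).trans h1
  have hfirst : ∑ k with 0 < subGap ν k, ℓ / (vLoc P.G 1 i * subGap ν k) =
      ℓ / vLoc P.G 1 i * S := by
    rw [hS, Finset.mul_sum]
    refine Finset.sum_congr rfl fun k _ => ?_
    rw [← div_div, div_eq_mul_inv (ℓ / _)]
  rw [hfirst]
  set X := ℓ / vLoc P.G 1 i * S with hX
  set Y := K * Real.log (1 / Δ) / (vMin P.G 1 * Δ) with hY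
  have hℓv : ℓ / V ≤ X := by
    calc ℓ / V ≤ ℓ / vLoc P.G 1 i * 1 := by rw [mul_one]; gcongr
      _ ≤ X := by rw [hX]; gcongr
  have hX0 : 0 ≤ X := by positivity
  have hlogΔ : 0 ≤ Real.log (1 / Δ) := Real.log_nonneg (by rw [le_div_iff₀ hΔ]; linarith)
  have hY0 : 0 ≤ Y := by positivity
  -- The epoch sums give no factor `ln(1/Δ)`. For `Δ ≤ 1/2` it is bounded below and can be inserted;
  -- for `Δ` near 1 it vanishes, and the first term takes over because `K ≤ ℓ / V`.
  have hZ : K / (vMin P.G 1 * Δ) ≤ 2 * (X + Y) := by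
    by_cases hhalf : Δ ≤ 1 / 2
    · have h1 : 1 / 2 ≤ Real.log (1 / Δ) := by
        have : Real.log 2 ≤ Real.log (1 / Δ) :=
          Real.log_le_log (by norm_num) (by rw [le_div_iff₀ hΔ]; linarith)
        linarith
      have h2 : K / (vMin P.G 1 * Δ) * (1 / 2) ≤ K / (vMin P.G 1 * Δ) * Real.log (1 / Δ) := by
        gcongr
      have h3 : K / (vMin P.G 1 * Δ) * Real.log (1 / Δ) = Y := by rw [hY]; ring
      linarith
    · have h1 : K / (vMin P.G 1 * Δ) ≤ 2 * K := by
        rw [div_le_iff₀ (by positivity)]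
        have h2 : 1 / 2 ≤ vMin P.G 1 * Δ :=
          (not_le.mp hhalf).le.trans (le_mul_of_one_le_left hΔ.le hvm1)
        have h3 := mul_le_mul_of_nonneg_left h2 (show (0 : ℝ) ≤ 2 * K by positivity)
        linarith
      have h2 : (K : ℝ) ≤ ℓ / V := by rw [le_div_iff₀ (by linarith)]; exact hKV
      linarith
  -- Here `205824 = 3 · 67 · 1024` and `43008 = 42 · 1024`, from at most `3ℓ` epochs and `λ ≤ 1024
  -- ℓ`.
  have hb := E.regret_le hP hT hν h01 hi
    (b := 205824 * (ℓ / (1 - 2 * P.α) * X) + 43008 * (ℓ / (1 - 2 * P.α) * (2 * (X + Y))))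
    (by positivity) ?_
  · refine hb.trans ?_
    have h1 : (K : ℝ) * 2 ^ V ≤ ℓ / (1 - 2 * P.α) * X := by
      have h2 : ℓ ≤ ℓ / (1 - 2 * P.α) := by
        rw [le_div_iff₀ hα]
        exact mul_le_of_le_one_right (by linarith) hα'
      have h3 : 1 ≤ X := le_trans (by rw [le_div_iff₀ (by linarith)]; linarith) hℓv
      exact hlarge.trans (h2.trans (le_mul_of_one_le_right (by positivity) h3))
    have h4 : 0 ≤ ℓ / (1 - 2 * P.α) * X := by positivity
    have h5 : 0 ≤ ℓ / (1 - 2 * P.α) * Y := by positivity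
    have h6 : ℓ / (1 - 2 * P.α) * (2 * (X + Y)) =
        2 * (ℓ / (1 - 2 * P.α) * X) + 2 * (ℓ / (1 - 2 * P.α) * Y) := by ring
    rw [h6, mul_add (ℓ / (1 - 2 * P.α))]
    linarith
  · intro ω hω
    refine (hP.sum_instRegret_le hT hVlam hν h01 hω hi hΔ).trans (add_le_add ?_ ?_)
    · calc _ ≤ 3 * ℓ * (67 * (1024 * ℓ) / ((1 - 2 * P.α) * vLoc P.G 1 i) * S) := by gcongr
        _ = _ := by rw [hX]; field_simp; ring
    · calc _ ≤ 42 * (1024 * ℓ * K / ((1 - 2 * P.α) * vMin P.G 1)) / Δ := by gcongr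
        _ = 43008 * (ℓ / (1 - 2 * P.α) * (K / (vMin P.G 1 * Δ))) := by field_simp; ring
        _ ≤ _ := by gcongr

end Setup

end DeMABAR

/-! ### The theorem -/

open DeMABAR MeasureTheory in
theorem theorem2 :
    ∃ C : ℝ, 0 < C ∧ ∀ (V K : ℕ) [NeZero K],
      (∀ P : Setup V K, P.Admissible → 1 ≤ P.T →
        (P.cost : ℝ) ≤ C * (V * Real.log (V * P.T))) ∧
      ∃ T₀ : ℕ, ∀ P : Setup V K, P.Admissible → T₀ ≤ P.T →
        ∀ ν : Fin K → Measure ℝ,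
          (∀ k, IsProbabilityMeasure (ν k)) →
          (∀ k, ∀ᵐ y ∂(ν k), y ∈ Set.Icc (0 : ℝ) 1) →
        ∀ (Ω : Type*) [MeasurableSpace Ω] (Q : Measure Ω) [IsProbabilityMeasure Q]
          (E : P.Environment ν Q) (i : Fin V), i ∉ P.byz →
          regret P ν E i ≤ C * (Real.log (V * P.T) / (1 - 2 * P.α) *
            ((∑ k with 0 < subGap ν k, Real.log (V * P.T) / (vLoc P.G 1 i * subGap ν k)) +
              K * Real.log (1 / minGap ν) / (vMin P.G 1 * minGap ν))) := by
  refine ⟨300000, by norm_num, fun V K _ => ⟨fun P hP hT => ?_, ?_⟩⟩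
  · refine (hP.cost_le hT).trans ?_
    have := Real.log_nonneg (hP.one_le_mul hT)
    gcongr
    norm_num
  -- The threshold makes `ln(VT) ≥ K 2^V`, which absorbs the cost of failure and gives `K V ≤
  -- ln(VT)`.
  · refine ⟨⌈Real.exp (K * 2 ^ V)⌉₊, fun P hP hT ν hν h01 Ω _ Q _ E i hi => ?_⟩
    have hexp : Real.exp (K * 2 ^ V) ≤ P.T := (Nat.le_ceil _).trans (by exact_mod_cast hT)
    have hpos : (0 : ℝ) < P.T := (Real.exp_pos _).trans_le hexp
    have hT1 : 1 ≤ P.T := by exact_mod_cast hpos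
    have hV1 : (1 : ℝ) ≤ V := by exact_mod_cast hP.pos_card
    refine E.regret_le_of_large hP hT1 ?_ hν h01 hi
    rw [Real.le_log_iff_exp_le (by positivity)]
    nlinarith
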